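/- Consider an uplink system in which $K\ge1$ single-antenna users reach a base station (BS) with $M$ antennas only through a hybrid reconfigurable surface (HRIS) with $N$ elements and $N_r$ reception chains. There are $B$ sub-frames of $T\ge1$ slots. In sub-frame $b$ the HRIS has the reflection matrix $\Psi(b)=\mathrm{diag}(\rho_l(b)e^{\jmath\psi_l(b)})_{l=1}^N$ and the $N_r\times N$ reception matrix $\Phi(b)$ with entries $(1-\rho_l(b))e^{\jmath\phi_{r,l}(b)}$ if element $l$ is connected to chain $r$ and $0$ otherwise, where $\rho_l(b)\in[0,1]$. Let $A=[\Phi(1)^T,\dots,\Phi(B)^T]^T$. The pilot matrix $S\in\mathbb C^{K\times T}$ satisfies $SS^H=T I_K$; the users transmit with power $P_t>0$, and the received signals are $$Y_{RC}(b)=\sqrt{P_t}\,\Phi(b)GS+Z_{RC}(b),\qquad Y_{BS}(b)=\sqrt{P_t}\,H\Psi(b)GS+Z_{BS}(b).$$ All entries of $H\in\mathbb C^{M\times N}$, $G\in\mathbb C^{N\times K}$, $Z_{RC}(b)\in\mathbb C^{N_r\times T}$ and $Z_{BS}(b)\in\mathbb C^{M\times T}$ are independent, circularly symmetric, zero-mean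 complex Gaussian, of variance $\beta>0$ for $H$, $\gamma_k>0$ for column $k$ of $G$, and $\sigma^2>0$ for both noises. Put $\Gamma=P_t/\sigma^2$, $R_G=(\sum_k\gamma_k)I_N$, $$R_{\tilde G}=\Big(R_G^{-1}+\tfrac{T\Gamma}{K}A^HA\Big)^{-1},\qquad \Sigma=R_GA^H\Big(AR_GA^H+\tfrac{K}{T\Gamma}I\Big)^{-1}AR_G^H .$$ The HRIS forms the linear estimate $\hat G=R_GA^H\big(AR_GA^H+\tfrac{K}{T\Gamma}I\big)^{-1}\tilde Y_{RC}$ of $G$, where $\tilde Y_{RC}=\frac1{T\sqrt{P_t}}Y_{RC}S^H$ and $Y_{RC}$ stacks the $Y_{RC}(b)$, and conveys it to the BS. Let $y_{BS}$ be the stacked vector of the $\mathrm{vec}\big(\frac1{T\sqrt{P_t}}Y_{BS}(b)S^H\big)$, $b=1,\dots,B$. Let $D(\Omega)$ be the $BK\times BK$ matrix whose $K\times K$ blocks are $$[D(\Omega)]_{i,j}=\tfrac{\beta}{K}\mathrm{Tr}\big(\Psi(j)^H\Psi(i)R_{\tilde G}\big)I_K+\mathbf 1_{\{i=j\}}(T\Gamma)^{-1}I_K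 ,$$ and let $$\mathcal E_H(\Omega)=\mathrm{Tr}\Big(\Big(\tfrac1\beta I_{MN}+\Big(K\sum_{j=1}^B\sum_{i=1}^B\mathrm{Tr}\big([D(\Omega)^{-T}]_{i,j}\big)\Psi(i)\Sigma\Psi(j)^H\Big)^T\otimes I_M\Big)^{-1}\Big).$$ Then $D(\Omega)$ and the matrix whose inverse is traced in $\mathcal E_H(\Omega)$ are Hermitian positive definite, so that $\mathcal E_H(\Omega)$ is well defined and real. Among all estimators $\hat h=W(\hat G)\,y_{BS}$ of $h=\mathrm{vec}(H)$ that are linear in $y_{BS}$ with coefficients depending measurably on $\hat G$, there is one of minimal mean squared error $\mathbb E\|h-\hat h\|^2$ (an LMMSE estimator), and the mean squared error of every such optimal estimator is finite and bounded below by the closed form $\mathcal E_H(\Omega)$. Consequently $\mathcal E_H(\Omega)$ is a lower bound for the error of every estimator of this form. -/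

import Mathlib

open MeasureTheory ProbabilityTheory Matrix
open scoped Kronecker ENNReal ComplexOrder

noncomputable section

/-- The circularly symmetric complex Gaussian law `CN(0, v)`: independent real and imaginary
parts, each of law `N(0, v / 2)`. -/
def complexGaussian (v : ℝ) : Measure ℂ :=
  ((gaussianReal 0 (v / 2).toNNReal).prod (gaussianReal 0 (v / 2).toNNReal)).map
    (fun p : ℝ × ℝ => (⟨p.1, p.2⟩ : ℂ))

/-- Deterministic parameters of an uplink system with `M` base-station antennas, `N` meta-atoms,
`K` single-antenna users, `Nr` reception chains at the hybrid surface, `T` slots per sub-frame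
and `B` sub-frames. -/
structure HRISSystem (M N K Nr T B : ℕ) where
  /-- which meta-atom is connected to which reception chain -/
  conn : Fin Nr → Fin N → Bool
  /-- reflected portion in each sub-frame -/
  ρ : Fin B → Fin N → ℝ
  ρ_mem : ∀ b l, ρ b l ∈ Set.Icc (0 : ℝ) 1
  /-- reflection phases -/
  ψ : Fin B → Fin N → ℝ
  /-- reception phases -/
  φ : Fin B → Fin Nr → Fin N → ℝ
  /-- path loss of the channel between surface and base station -/
  β : ℝ
  β_pos : 0 < β
  /-- path losses of the channels between users and surface -/
  γ : Fin K → ℝ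
  γ_pos : ∀ k, 0 < γ k
  /-- noise variance, the same at the surface and at the base station -/
  σsq : ℝ
  σsq_pos : 0 < σsq
  /-- transmit power of each user -/
  Pt : ℝ
  Pt_pos : 0 < Pt
  /-- pilots; row `k` is the sequence of user `k` -/
  S : Matrix (Fin K) (Fin T) ℂ
  S_orth : S * Sᴴ = (T : ℂ) • (1 : Matrix (Fin K) (Fin K) ℂ)

namespace HRISSystem

variable {M N K Nr T B : ℕ} (s : HRISSystem M N K Nr T B)

/-- Transmit SNR. -/
def Γ : ℝ := s.Pt / s.σsq

/-- Reception (analog combining) matrix in sub-frame `b`. -/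
def Phi (b : Fin B) : Matrix (Fin Nr) (Fin N) ℂ :=
  Matrix.of fun r l =>
    if s.conn r l then ((1 - s.ρ b l : ℝ) : ℂ) * Complex.exp (Complex.I * (s.φ b r l : ℂ)) else 0

/-- Reflection matrix in sub-frame `b`. -/
def Psi (b : Fin B) : Matrix (Fin N) (Fin N) ℂ :=
  Matrix.diagonal fun l => (s.ρ b l : ℂ) * Complex.exp (Complex.I * (s.ψ b l : ℂ))

/-- The reception matrices of all sub-frames, stacked. -/
def Arc : Matrix (Fin B × Fin Nr) (Fin N) ℂ :=
  Matrix.of fun p l => s.Phi p.1 p.2 l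

/-- `R_G = (∑ γ_k) I_N`. -/
def RG : Matrix (Fin N) (Fin N) ℂ := ((∑ k, s.γ k : ℝ) : ℂ) • 1

/-- `(A_RC R_G A_RCᴴ + K (T Γ)⁻¹ I)`. -/
def Rrc : Matrix (Fin B × Fin Nr) (Fin B × Fin Nr) ℂ :=
  s.Arc * s.RG * s.Arcᴴ + (((K : ℝ) * ((T : ℝ) * s.Γ)⁻¹ : ℝ) : ℂ) • 1

/-- The linear estimation matrix for the user channels that is used at the surface. -/
def Mo : Matrix (Fin N) (Fin B × Fin Nr) ℂ := s.RG * s.Arcᴴ * (s.Rrc)⁻¹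

/-- `Σ(Φ)`. -/
def Sigma : Matrix (Fin N) (Fin N) ℂ := s.RG * s.Arcᴴ * (s.Rrc)⁻¹ * s.Arc * s.RGᴴ

/-- Error covariance `R_G̃(Φ)`. -/
def RGerr : Matrix (Fin N) (Fin N) ℂ :=
  ((s.RG)⁻¹ + (((T : ℝ) * s.Γ * (K : ℝ)⁻¹ : ℝ) : ℂ) • (s.Arcᴴ * s.Arc))⁻¹

/-- The `K × K` block `(i, j)` of `D(Ω)`. -/
def DBlock (i j : Fin B) : Matrix (Fin K) (Fin K) ℂ :=
  if i = j then
    (((s.β / K : ℝ) : ℂ) * ((s.Psi j)ᴴ * s.Psi i * s.RGerr).trace) • 1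
      + ((((T : ℝ) * s.Γ)⁻¹ : ℝ) : ℂ) • 1
  else
    (((s.β / K : ℝ) : ℂ) * ((s.Psi j)ᴴ * s.Psi i * s.RGerr).trace) • 1

/-- The `BK × BK` block matrix `D(Ω)`. -/
def D : Matrix (Fin B × Fin K) (Fin B × Fin K) ℂ :=
  Matrix.of fun p q => s.DBlock p.1 q.1 p.2 q.2

/-- The block `(i, j)` of `D(Ω)^{-T}`. -/
def DinvTBlock (i j : Fin B) : Matrix (Fin K) (Fin K) ℂ :=
  Matrix.of fun k k' => ((s.D)⁻¹)ᵀ (i, k) (j, k')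

/-- The matrix whose inverse has trace `E_H(Ω)`. -/
def infoH : Matrix (Fin N × Fin M) (Fin N × Fin M) ℂ :=
  ((s.β⁻¹ : ℝ) : ℂ) • 1 +
    ((K : ℂ) • ∑ j, ∑ i, (s.DinvTBlock i j).trace • (s.Psi i * s.Sigma * (s.Psi j)ᴴ))ᵀ
      ⊗ₖ (1 : Matrix (Fin M) (Fin M) ℂ)

/-- The closed-form expression `E_H(Ω)`. -/
def EH : ℂ := ((s.infoH)⁻¹).trace

/-- The random quantities: both channels and the additive noises, as matrices with independent
complex Gaussian entries. -/
structure Channels {Ω : Type*} [MeasurableSpace Ω] (P : Measure Ω) where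
  /-- channel between surface and base station -/
  H : Ω → Matrix (Fin M) (Fin N) ℂ
  /-- channel between users and surface; column `k` belongs to user `k` -/
  G : Ω → Matrix (Fin N) (Fin K) ℂ
  /-- noise at the surface in each sub-frame -/
  Zrc : Ω → Fin B → Matrix (Fin Nr) (Fin T) ℂ
  /-- noise at the base station in each sub-frame -/
  Zbs : Ω → Fin B → Matrix (Fin M) (Fin T) ℂ
  law_H : ∀ m l, HasLaw (fun ω => H ω m l) (complexGaussian s.β) P
  law_G : ∀ l k, HasLaw (fun ω => G ω l k) (complexGaussian (s.γ k)) P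
  law_Zrc : ∀ b r t, HasLaw (fun ω => Zrc ω b r t) (complexGaussian s.σsq) P
  law_Zbs : ∀ b m t, HasLaw (fun ω => Zbs ω b m t) (complexGaussian s.σsq) P
  /-- all scalar entries of the four families are mutually independent -/
  indep : iIndepFun (β := fun _ => ℂ)
    (Sum.elim (fun (p : Fin M × Fin N) ω => H ω p.1 p.2)
      (Sum.elim (fun (p : Fin N × Fin K) ω => G ω p.1 p.2)
        (Sum.elim (fun (p : Fin B × Fin Nr × Fin T) ω => Zrc ω p.1 p.2.1 p.2.2)
          (fun (p : Fin B × Fin M × Fin T) ω => Zbs ω p.1 p.2.1 p.2.2)))) P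

namespace Channels

variable {s} {Ω : Type*} [MeasurableSpace Ω] {P : Measure Ω} (c : s.Channels P)

/-- Signal received at the surface in sub-frame `b`. -/
def yRC (ω : Ω) (b : Fin B) : Matrix (Fin Nr) (Fin T) ℂ :=
  ((√s.Pt : ℝ) : ℂ) • (s.Phi b * c.G ω * s.S) + c.Zrc ω b

/-- Signal received at the base station in sub-frame `b`. -/
def yBS (ω : Ω) (b : Fin B) : Matrix (Fin M) (Fin T) ℂ :=
  ((√s.Pt : ℝ) : ℂ) • (c.H ω * s.Psi b * c.G ω * s.S) + c.Zbs ω b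

/-- Projection of the stacked signal at the surface on the pilots. -/
def yRCProj (ω : Ω) : Matrix (Fin B × Fin Nr) (Fin K) ℂ :=
  ((((T : ℝ) * √s.Pt)⁻¹ : ℝ) : ℂ) • ((Matrix.of fun p t => c.yRC ω p.1 p.2 t) * s.Sᴴ)

/-- The estimate `Ĝ` of the user channels that the surface conveys to the base station. -/
def Ghat (ω : Ω) : Matrix (Fin N) (Fin K) ℂ := s.Mo * c.yRCProj ω

/-- Projection of the signal at the base station on the pilots. -/
def yBSProj (ω : Ω) (b : Fin B) : Matrix (Fin M) (Fin K) ℂ :=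
  ((((T : ℝ) * √s.Pt)⁻¹ : ℝ) : ℂ) • (c.yBS ω b * s.Sᴴ)

/-- The stacked vectors `vec (ỹ_BS(1)), …, vec (ỹ_BS(B))`. -/
def yBSVec (ω : Ω) : (Fin B × Fin K) × Fin M → ℂ :=
  fun p => (c.yBSProj ω p.1.1).vec (p.1.2, p.2)

end Channels

/-- An estimator at the base station that is linear in the observation, with coefficients that
depend measurably on the estimate `Ĝ` of the user channels. -/
structure LinEst (M N K B : ℕ) where
  /-- coefficient matrix as a function of `Ĝ` -/
  W : Matrix (Fin N) (Fin K) ℂ → Matrix (Fin N × Fin M) ((Fin B × Fin K) × Fin M) ℂ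
  measurable_W : ∀ i j, Measurable fun g : Fin N → Fin K → ℂ => W (Matrix.of g) i j

/-- Mean squared error of a linear estimator of `h = vec H`. -/
def Channels.mse {s : HRISSystem M N K Nr T B} {Ω : Type*} [MeasurableSpace Ω] {P : Measure Ω}
    (c : s.Channels P) (e : LinEst M N K B) : ℝ≥0∞ :=
  ∫⁻ ω, ∑ i, ‖(c.H ω).vec i - (e.W (c.Ghat ω) *ᵥ c.yBSVec ω) i‖ₑ ^ 2 ∂P

/-- A linear minimum mean squared error (LMMSE) estimator of `h = vec H`. -/
def Channels.IsLMMSE {s : HRISSystem M N K Nr T B} {Ω : Type*} [MeasurableSpace Ω]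
    {P : Measure Ω} (c : s.Channels P) (e : LinEst M N K B) : Prop :=
  ∀ e' : LinEst M N K B, c.mse e ≤ c.mse e'

end HRISSystem

end

/-!
# A lower bound for channel estimation with a hybrid reconfigurable surface

After projection on the pilots, the base station observes `y = (U(G) ⊗ I_M) h + n`, where the entry
of `U(G)` at `(b, k), l` is `Ψ(b)ₗ Gₗₖ` and `n` is white of variance `τ = (T Γ)⁻¹`. The estimator
knows `Ĝ`, a linear function of the signal at the surface.

*Reduction.* Let `Ḡ` be the minimum mean squared error estimate of `G`, user by user. The error
`G - Ḡ` is uncorrelated with the signal at the surface, hence independent of it, since circularly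
symmetric Gaussian families are independent as soon as they are uncorrelated
(`indepFun_mulVec_of_mul_diagonal_mul_eq_zero`). Integrating first over `(H, n)` and then over
`G - Ḡ` shows that the mean squared error of an estimator is the average of `risk β L (U(Ḡ) ⊗ I) W`
for a deterministic effective noise covariance `L` (`mse_eq`).

*Existence.* By a push-through identity `Ḡ` is a linear function of `Ĝ`, so the pointwise minimiser
of the risk, a Wiener filter, is an admissible estimator (`exists_isLMMSE`).

*Lower bound.* Completing squares bounds the risk from below by an expression affine in the
information `U(Ḡ)ᴴ L'⁻¹ U(Ḡ)`, for every `L' ≤ L` and every matrix `V` (`le_risk`). This replaces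
Jensen's inequality for `X ↦ trace X⁻¹`. With `Λ` the `B × B` matrix such that `D(Ω) = Λ ⊗ I_K` and
`s_k = γ_k / ∑ γ`, the choice `L' = Λ ⊗ diag(s_k) ⊗ I_M` works (`posSemidef_condCov_sub`), and the
expectation of the information is then at most the information in the closed form
(`posSemidef_infoMap_sub_sum`). Both comparisons are monotonicity statements for the Loewner order
in the variances of a linear model in white noise; the closed form overstates the information by a
factor `K ^ 2` for equal path gains, and this slack absorbs unequal ones. Taking for `V` the inverse
of the information matrix of the closed form gives exactly its trace (`ofReal_EH_le_mse`).
-/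

noncomputable section

/-! ### Positive semidefinite matrices and quadratic risks -/

namespace Matrix

variable {m n o : Type*} [Fintype m] [Fintype n] [Fintype o]
  [DecidableEq m] [DecidableEq n] [DecidableEq o]

/-- Inversion is antitone for the Loewner order: both sides express that the block matrix
`[B, 1; 1, A⁻¹]` is positive semidefinite, through its two Schur complements. -/
lemma PosDef.posSemidef_inv_sub_inv {A B : Matrix n n ℂ} (hA : A.PosDef)
    (hAB : (B - A).PosSemidef) : (A⁻¹ - B⁻¹).PosSemidef := by
  have hB : B.PosDef := by simpa using hA.add_posSemidef hAB
  let := hA.inv.isUnit.invertible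
  let := hB.isUnit.invertible
  have h := (hA.inv.fromBlocks₂₂ B 1).2 (by
    simpa [nonsing_inv_nonsing_inv _ ((isUnit_iff_isUnit_det _).1 hA.isUnit)] using hAB)
  simpa using (hB.fromBlocks₁₁ 1 A⁻¹).1 h

lemma sub_kronecker {l m n p : Type*} (A₁ A₂ : Matrix l m ℂ) (B : Matrix n p ℂ) :
    (A₁ - A₂) ⊗ₖ B = A₁ ⊗ₖ B - A₂ ⊗ₖ B := by
  ext; simp [sub_mul]

omit [DecidableEq n] in
lemma PosSemidef.re_trace_nonneg {A : Matrix n n ℂ} (hA : A.PosSemidef) : 0 ≤ A.trace.re :=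
  (Complex.nonneg_iff.1 hA.trace_nonneg).1

/-- The mean squared error of the estimate `W (U x + z)` of `x`, for uncorrelated `x` and `z` with
covariance matrices `β • 1` and `L`. -/
def risk (β : ℝ) (L : Matrix m m ℂ) (U : Matrix m n ℂ) (W : Matrix n m ℂ) : ℝ :=
  (β • ((1 - W * U) * (1 - W * U)ᴴ) + W * L * Wᴴ).trace.re

/-- The linear minimum mean squared error filter, the minimiser of `risk β L U`. -/
def wiener (β : ℝ) (L : Matrix m m ℂ) (U : Matrix m n ℂ) : Matrix n m ℂ :=
  β • (Uᴴ * (β • (U * Uᴴ) + L)⁻¹)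

omit [DecidableEq m] in
lemma risk_nonneg {β : ℝ} (hβ : 0 ≤ β) {L : Matrix m m ℂ} (hL : L.PosSemidef) (U : Matrix m n ℂ)
    (W : Matrix n m ℂ) : 0 ≤ risk β L U W :=
  (((posSemidef_self_mul_conjTranspose _).smul hβ).add
    (hL.mul_mul_conjTranspose_same W)).re_trace_nonneg

/-- Completion of the square around the Wiener filter. -/
lemma risk_wiener_le {β : ℝ} (hβ : 0 ≤ β) {L : Matrix m m ℂ} (hL : L.PosDef) (U : Matrix m n ℂ)
    (W : Matrix n m ℂ) : risk β L U (wiener β L U) ≤ risk β L U W := by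
  set R : Matrix m m ℂ := β • (U * Uᴴ) + L with hR
  have hRpd : R.PosDef :=
    PosDef.posSemidef_add ((posSemidef_self_mul_conjTranspose U).smul hβ) hL
  have hdet := (isUnit_iff_isUnit_det _).1 hRpd.isUnit
  have hRi : (R⁻¹)ᴴ = R⁻¹ := hRpd.inv.isHermitian
  have hdet' : R⁻¹ * R = 1 := nonsing_inv_mul _ hdet
  have key : ∀ W : Matrix n m ℂ, β • ((1 - W * U) * (1 - W * U)ᴴ) + W * L * Wᴴ
      = (W - wiener β L U) * R * (W - wiener β L U)ᴴ
        + (β • (1 : Matrix n n ℂ) - (β * β) • (Uᴴ * R⁻¹ * U)) := by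
    intro W
    have h1 : (W - wiener β L U) * R = W * R - β • Uᴴ := by
      rw [Matrix.sub_mul, wiener, ← hR, Matrix.smul_mul, Matrix.mul_assoc, hdet', Matrix.mul_one]
    have h2 : R * R⁻¹ = 1 := mul_nonsing_inv _ hdet
    have h3 : (wiener β L U)ᴴ = β • (R⁻¹ * U) := by
      rw [wiener, ← hR]; simp [hRi]
    have h4 : (W * R - β • Uᴴ) * (Wᴴ - β • (R⁻¹ * U))
        = W * R * Wᴴ - β • Uᴴ * Wᴴ - (β • (W * U) - β • Uᴴ * (β • (R⁻¹ * U))) := by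
      rw [Matrix.mul_sub, Matrix.sub_mul, Matrix.sub_mul, Matrix.mul_smul (W * R),
        Matrix.mul_assoc W R (R⁻¹ * _), ← Matrix.mul_assoc R, h2, Matrix.one_mul]
    rw [h1, conjTranspose_sub W, h3, h4, hR]
    simp only [conjTranspose_sub, conjTranspose_mul, conjTranspose_one, Matrix.sub_mul,
      Matrix.mul_sub, Matrix.mul_add, Matrix.add_mul, smul_sub, Matrix.smul_mul, Matrix.mul_smul,
      Matrix.one_mul, Matrix.mul_one, Matrix.mul_assoc,
      smul_smul]
    abel
  unfold risk
  rw [key, key W]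
  have := ((hRpd.posSemidef).mul_mul_conjTranspose_same (W - wiener β L U)).re_trace_nonneg
  simpa [trace_add] using this

/-- A lower bound for the risk that is affine in `Uᴴ * L'⁻¹ * U`. It comes from linearising
`X ↦ trace X⁻¹`, and every matrix `V` gives one such bound. -/
lemma le_risk {β : ℝ} (hβ : 0 < β) {L L' : Matrix m m ℂ} (hL' : L'.PosDef)
    (hL : (L - L').PosSemidef) (U : Matrix m n ℂ) (W : Matrix n m ℂ) (V : Matrix n n ℂ) :
    2 * V.trace.re - (β⁻¹ • (V * Vᴴ)).trace.re - (V * (Uᴴ * L'⁻¹ * U) * Vᴴ).trace.re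
      ≤ risk β L U W := by
  have hdet := (isUnit_iff_isUnit_det _).1 hL'.isUnit
  have hi : (L'⁻¹)ᴴ = L'⁻¹ := hL'.inv.isHermitian
  have h1 : L'⁻¹ * L' = 1 := nonsing_inv_mul _ hdet
  have h2 : L' * L'⁻¹ = 1 := mul_nonsing_inv _ hdet
  have key : β • ((1 - W * U) * (1 - W * U)ᴴ) + W * L * Wᴴ
      = β • ((1 - W * U - β⁻¹ • V) * (1 - W * U - β⁻¹ • V)ᴴ)
        + (W - V * Uᴴ * L'⁻¹) * L' * (W - V * Uᴴ * L'⁻¹)ᴴ + W * (L - L') * Wᴴ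
        + (V + Vᴴ - β⁻¹ • (V * Vᴴ) - V * (Uᴴ * L'⁻¹ * U) * Vᴴ) := by
    have h3 : (W - V * Uᴴ * L'⁻¹) * L' = W * L' - V * Uᴴ := by
      rw [Matrix.sub_mul, Matrix.mul_assoc _ L'⁻¹, h1, Matrix.mul_one]
    have h4 : (W - V * Uᴴ * L'⁻¹)ᴴ = Wᴴ - L'⁻¹ * (U * Vᴴ) := by simp [hi]
    have h5 : (W * L' - V * Uᴴ) * (Wᴴ - L'⁻¹ * (U * Vᴴ))
        = W * L' * Wᴴ - V * Uᴴ * Wᴴ - (W * (U * Vᴴ) - V * Uᴴ * (L'⁻¹ * (U * Vᴴ))) := by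
      rw [Matrix.mul_sub, Matrix.sub_mul, Matrix.sub_mul, Matrix.mul_assoc W L' (L'⁻¹ * _),
        ← Matrix.mul_assoc L', h2, Matrix.one_mul]
    rw [h3, h4, h5]
    simp only [conjTranspose_sub, conjTranspose_mul, conjTranspose_one, Matrix.sub_mul,
      Matrix.mul_sub, smul_sub, Matrix.smul_mul, Matrix.mul_smul, Matrix.one_mul,
      Matrix.mul_one, Matrix.mul_assoc, smul_smul, conjTranspose_smul, star_trivial, mul_inv_cancel₀ hβ.ne', one_smul,
      mul_inv_cancel_left₀ hβ.ne']
    abel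
  unfold risk
  rw [key]
  have p1 := ((posSemidef_self_mul_conjTranspose (1 - W * U - β⁻¹ • V)).smul hβ.le).re_trace_nonneg
  have p2 := (hL'.posSemidef.mul_mul_conjTranspose_same (W - V * Uᴴ * L'⁻¹)).re_trace_nonneg
  have p3 := (hL.mul_mul_conjTranspose_same W).re_trace_nonneg
  have hV : (Vᴴ).trace.re = V.trace.re := by rw [trace_conjTranspose]; simp
  simp only [trace_add, trace_sub, Complex.add_re, Complex.sub_re, hV] at *
  linarith

omit [DecidableEq m] [DecidableEq n] in
open scoped MatrixOrder Matrix.Norms.L2Operator in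
/-- A generalised Schur product of two positive semidefinite matrices is positive semidefinite. -/
lemma posSemidef_sum_sum_smul {X : Matrix o o ℂ} {S : Matrix n n ℂ} (hX : X.PosSemidef)
    (hS : S.PosSemidef) (Ψ : o → Matrix m n ℂ) :
    (∑ j, ∑ i, X j i • (Ψ i * S * (Ψ j)ᴴ)).PosSemidef := by
  obtain ⟨Y, rfl⟩ := CStarAlgebra.nonneg_iff_eq_star_mul_self.1 (nonneg_iff_posSemidef.2 hX)
  have : ∑ j, ∑ i, (star Y * Y) j i • (Ψ i * S * (Ψ j)ᴴ)
      = ∑ r, (∑ i, Y r i • Ψ i) * S * (∑ i, Y r i • Ψ i)ᴴ := by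
    simp only [mul_apply, star_apply, conjTranspose_sum, conjTranspose_smul, Matrix.sum_mul,
      Matrix.mul_sum, Finset.sum_smul, Matrix.smul_mul, Matrix.mul_smul]
    simp only [Finset.smul_sum, smul_smul]
    rw [Finset.sum_comm (s := Finset.univ) (t := Finset.univ)
      (f := fun r j => ∑ i, (star (Y r j) * Y r i) • (Ψ i * S * (Ψ j)ᴴ))]
    exact Finset.sum_congr rfl fun j _ => Finset.sum_comm
  rw [this]
  exact posSemidef_sum _ fun r _ => hS.mul_mul_conjTranspose_same _

end Matrix

/-! ### Complex Gaussian vectors -/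

namespace ProbabilityTheory

variable {Ω : Type*} [MeasurableSpace Ω] {P : Measure Ω}
variable {ι κ κ' : Type*} [Fintype ι] [Fintype κ] [Fintype κ']

/-- A centred square-integrable complex random vector `x` with covariance matrix
`C = 𝔼[x xᴴ]`. Nothing is required of the pseudo-covariance `𝔼[x xᵀ]`. -/
structure HasCov (x : Ω → ι → ℂ) (C : Matrix ι ι ℂ) (P : Measure Ω) : Prop where
  memLp : ∀ i, MemLp (fun ω => x ω i) 2 P
  mean : ∀ i, ∫ ω, x ω i ∂P = 0
  cov : ∀ i j, ∫ ω, x ω i * star (x ω j) ∂P = C i j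

namespace HasCov

variable {x : Ω → ι → ℂ} {C : Matrix ι ι ℂ}

omit [Fintype ι] in
lemma integrable [IsFiniteMeasure P] (h : HasCov x C P) (i : ι) :
    Integrable (fun ω => x ω i) P := (h.memLp i).integrable (by norm_num)

omit [Fintype ι] in
lemma integrable_mul_star (h : HasCov x C P) (i j : ι) :
    Integrable (fun ω => x ω i * star (x ω j)) P :=
  (h.memLp i).integrable_mul (h.memLp j).star

omit [Fintype κ] in
/-- Covariance matrices transform under linear maps. -/
lemma mulVec [IsFiniteMeasure P] (h : HasCov x C P) (A : Matrix κ ι ℂ) :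
    HasCov (fun ω => A *ᵥ x ω) (A * C * Aᴴ) P where
  memLp k := by
    simp only [Matrix.mulVec, dotProduct]
    exact memLp_finsetSum _ fun i _ => (h.memLp i).const_mul _
  mean k := by
    simp only [Matrix.mulVec, dotProduct]
    rw [integral_finsetSum _ fun i _ => (h.integrable i).const_mul _]
    simp [integral_const_mul, h.mean]
  cov k k' := by
    have : ∀ ω, (A *ᵥ x ω) k * star ((A *ᵥ x ω) k')
        = ∑ i, ∑ j, A k i * star (A k' j) * (x ω i * star (x ω j)) := by
      intro ω
      simp only [Matrix.mulVec, dotProduct, star_sum, star_mul', Finset.sum_mul_sum]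
      exact Finset.sum_congr rfl fun i _ => Finset.sum_congr rfl fun j _ => by ring
    simp_rw [this]
    have hint := fun i j => (h.integrable_mul_star i j).const_mul (A k i * star (A k' j))
    rw [integral_finsetSum _ fun i _ => integrable_finsetSum _ fun j _ => hint i j]
    simp_rw [integral_finsetSum _ fun j _ => hint _ j, integral_const_mul, h.cov]
    simp only [Matrix.mul_apply, conjTranspose_apply, Finset.sum_mul]
    rw [Finset.sum_comm]
    exact Finset.sum_congr rfl fun i _ => Finset.sum_congr rfl fun j _ => by ring

lemma lintegral_enorm_sq (h : HasCov x C P) :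
    ∫⁻ ω, ∑ i, ‖x ω i‖ₑ ^ 2 ∂P = ENNReal.ofReal C.trace.re := by
  have hsq : ∀ ω i, ‖x ω i‖ₑ ^ 2 = ENNReal.ofReal ((x ω i * star (x ω i)).re) := by
    intro ω i
    rw [← ofReal_norm, ← ENNReal.ofReal_pow (norm_nonneg _)]
    congr 1
    rw [Complex.star_def, Complex.mul_conj, Complex.normSq_eq_norm_sq, Complex.ofReal_re]
  have hnn : ∀ ω i, 0 ≤ (x ω i * star (x ω i)).re := by
    intro ω i
    simp [Complex.mul_conj, Complex.normSq_nonneg]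
  simp_rw [hsq, ← ENNReal.ofReal_sum_of_nonneg fun i _ => hnn _ i]
  have hint : ∀ i, Integrable (fun ω => (x ω i * star (x ω i)).re) P :=
    fun i => (h.integrable_mul_star i i).re
  rw [← ofReal_integral_eq_lintegral_ofReal (integrable_finsetSum _ fun i _ => hint i)
    (Filter.Eventually.of_forall fun ω => Finset.sum_nonneg fun i _ => hnn ω i),
    integral_finsetSum _ fun i _ => hint i, Matrix.trace, Complex.re_sum]
  congr 1
  refine Finset.sum_congr rfl fun i _ => ?_
  rw [Matrix.diag_apply, ← h.cov]
  exact integral_re (h.integrable_mul_star i i)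

end HasCov

section complexGaussian

variable (v : ℝ)

lemma complexGaussian_eq_map_equivRealProdCLM :
    complexGaussian v = ((gaussianReal 0 (v / 2).toNNReal).prod
      (gaussianReal 0 (v / 2).toNNReal)).map Complex.equivRealProdCLM.symm := rfl

instance : IsGaussian (complexGaussian v) := by
  rw [complexGaussian_eq_map_equivRealProdCLM]
  infer_instance

lemma integral_complexGaussian (f : ℂ → ℝ) :
    ∫ z, f z ∂complexGaussian v = ∫ p, f ⟨p.1, p.2⟩ ∂(gaussianReal 0 (v / 2).toNNReal).prod
      (gaussianReal 0 (v / 2).toNNReal) :=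
  Complex.equivRealProdCLM.symm.toHomeomorph.measurableEmbedding.integral_map _

lemma integral_sq_gaussianReal (w : NNReal) : ∫ t, t * t ∂gaussianReal 0 w = w := by
  have := variance_fun_id_gaussianReal (μ := 0) (v := w)
  rw [variance_eq_integral (by fun_prop)] at this
  simpa [integral_id_gaussianReal, sq] using this

lemma integral_re_complexGaussian : ∫ z, z.re ∂complexGaussian v = 0 := by
  rw [integral_complexGaussian]
  simpa using integral_prod_mul (μ := gaussianReal 0 (v / 2).toNNReal)
    (ν := gaussianReal 0 (v / 2).toNNReal) (fun t : ℝ => t) (fun _ : ℝ => (1 : ℝ))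

lemma integral_im_complexGaussian : ∫ z, z.im ∂complexGaussian v = 0 := by
  rw [integral_complexGaussian]
  simpa using integral_prod_mul (μ := gaussianReal 0 (v / 2).toNNReal)
    (ν := gaussianReal 0 (v / 2).toNNReal) (fun _ : ℝ => (1 : ℝ)) (fun t : ℝ => t)

variable {v}

lemma integral_re_mul_re_complexGaussian (hv : 0 ≤ v) :
    ∫ z, z.re * z.re ∂complexGaussian v = v / 2 := by
  rw [integral_complexGaussian]
  have := integral_prod_mul (μ := gaussianReal 0 (v / 2).toNNReal)
    (ν := gaussianReal 0 (v / 2).toNNReal) (fun t : ℝ => t * t) (fun _ : ℝ => (1 : ℝ))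
  simpa [integral_sq_gaussianReal, div_nonneg hv] using this

lemma integral_im_mul_im_complexGaussian (hv : 0 ≤ v) :
    ∫ z, z.im * z.im ∂complexGaussian v = v / 2 := by
  rw [integral_complexGaussian]
  have := integral_prod_mul (μ := gaussianReal 0 (v / 2).toNNReal)
    (ν := gaussianReal 0 (v / 2).toNNReal) (fun _ : ℝ => (1 : ℝ)) (fun t : ℝ => t * t)
  simpa [integral_sq_gaussianReal, div_nonneg hv] using this

variable (v) in
lemma integral_re_mul_im_complexGaussian : ∫ z, z.re * z.im ∂complexGaussian v = 0 := by
  rw [integral_complexGaussian]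
  have := integral_prod_mul (μ := gaussianReal 0 (v / 2).toNNReal)
    (ν := gaussianReal 0 (v / 2).toNNReal) (fun t : ℝ => t) (fun t : ℝ => t)
  simpa using this

lemma memLp_re_complexGaussian : MemLp Complex.re 2 (complexGaussian v) :=
  (IsGaussian.memLp_two_id (μ := complexGaussian v)).re

lemma memLp_im_complexGaussian : MemLp Complex.im 2 (complexGaussian v) :=
  (IsGaussian.memLp_two_id (μ := complexGaussian v)).im

lemma integral_id_complexGaussian : ∫ z, z ∂complexGaussian v = 0 := by
  have hi : Integrable (fun z : ℂ => z) (complexGaussian v) :=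
    IsGaussian.integrable_id
  apply Complex.ext
  · exact (integral_re hi).symm.trans (integral_re_complexGaussian v)
  · exact (integral_im hi).symm.trans (integral_im_complexGaussian v)

lemma integral_mul_star_complexGaussian (hv : 0 ≤ v) :
    ∫ z, z * star z ∂complexGaussian v = v := by
  have : ∀ z : ℂ, z * star z = ((z.re * z.re + z.im * z.im : ℝ) : ℂ) := fun z => by
    simp [Complex.mul_conj, Complex.normSq_apply]
  simp_rw [this]
  have h1 : Integrable (fun z => z.re * z.re) (complexGaussian v) :=
    memLp_re_complexGaussian.integrable_mul memLp_re_complexGaussian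
  have h2 : Integrable (fun z => z.im * z.im) (complexGaussian v) :=
    memLp_im_complexGaussian.integrable_mul memLp_im_complexGaussian
  rw [integral_complex_ofReal, integral_add h1 h2, integral_re_mul_re_complexGaussian hv,
    integral_im_mul_im_complexGaussian hv]
  simp

/-- Circular symmetry enters here: the covariance of two real linear forms of a complex Gaussian
variable is determined by the variance alone. -/
lemma integral_re_mul_re_mul_complexGaussian (hv : 0 ≤ v) (a b : ℂ) :
    ∫ z, (a * z).re * (b * z).re ∂complexGaussian v = v / 2 * (a * star b).re := by
  have h1 : Integrable (fun z => a.re * b.re * (z.re * z.re)) (complexGaussian v) :=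
    (memLp_re_complexGaussian.integrable_mul memLp_re_complexGaussian).const_mul _
  have h2 : Integrable (fun z => a.im * b.im * (z.im * z.im)) (complexGaussian v) :=
    (memLp_im_complexGaussian.integrable_mul memLp_im_complexGaussian).const_mul _
  have h3 : Integrable (fun z => (a.re * b.im + a.im * b.re) * (z.re * z.im))
      (complexGaussian v) :=
    (memLp_re_complexGaussian.integrable_mul memLp_im_complexGaussian).const_mul _
  have : ∀ z : ℂ, (a * z).re * (b * z).re = a.re * b.re * (z.re * z.re)
      + a.im * b.im * (z.im * z.im) - (a.re * b.im + a.im * b.re) * (z.re * z.im) := fun z => by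
    simp; ring
  simp_rw [this]
  have h12 : Integrable (fun z : ℂ => a.re * b.re * (z.re * z.re) + a.im * b.im * (z.im * z.im))
      (complexGaussian v) := h1.add h2
  rw [integral_sub h12 h3, integral_add h1 h2]
  simp only [integral_const_mul, integral_re_mul_re_complexGaussian hv,
    integral_im_mul_im_complexGaussian hv, integral_re_mul_im_complexGaussian]
  simp; ring

end complexGaussian

/-- Every real functional on `κ → ℂ` is the real part of a complex linear form. -/
lemma exists_eq_re_dotProduct (L : StrongDual ℝ (κ → ℂ)) :
    ∃ p : κ → ℂ, ∀ z, L z = (p ⬝ᵥ z).re := by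
  classical
  refine ⟨fun r => L (Pi.single r 1) - Complex.I * L (Pi.single r Complex.I), fun z => ?_⟩
  have hz : z = ∑ r, ((z r).re • (Pi.single r (1 : ℂ) : κ → ℂ)
      + (z r).im • (Pi.single r Complex.I : κ → ℂ)) := by
    ext r
    simp [Finset.sum_apply, Pi.single_apply, Finset.sum_add_distrib, Complex.re_add_im]
  conv_lhs => rw [hz]
  simp [dotProduct, mul_comm]

/-! ### Families of independent complex Gaussian variables -/

section family

variable [IsProbabilityMeasure P] [DecidableEq ι] {ξ : ι → Ω → ℂ} {v : ι → ℝ}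

omit [Fintype ι] [DecidableEq ι] [IsProbabilityMeasure P] in
lemma memLp_of_hasLaw_complexGaussian {X : Ω → ℂ} {w : ℝ} (h : HasLaw X (complexGaussian w) P) :
    MemLp X 2 P := by
  have := IsGaussian.memLp_two_id (μ := complexGaussian w)
  rw [← h.map_eq] at this
  exact (memLp_map_measure_iff this.aestronglyMeasurable h.aemeasurable).1 this

omit [Fintype ι] [IsProbabilityMeasure P] in
lemma hasCov_of_iIndepFun (hv : ∀ i, 0 ≤ v i) (hlaw : ∀ i, HasLaw (ξ i) (complexGaussian (v i)) P)
    (hind : iIndepFun ξ P) :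
    HasCov (fun ω i => ξ i ω) (diagonal fun i => (v i : ℂ)) P where
  memLp i := memLp_of_hasLaw_complexGaussian (hlaw i)
  mean i := by
    rw [(hlaw i).integral_eq, integral_id_complexGaussian]
  cov i j := by
    have hm := fun i => (memLp_of_hasLaw_complexGaussian (hlaw i)).aestronglyMeasurable
    rcases eq_or_ne i j with rfl | hij
    · rw [diagonal_apply_eq, ← integral_mul_star_complexGaussian (hv i)]
      exact (hlaw i).integral_comp (f := fun z => z * star z)
        (by fun_prop : Continuous fun z : ℂ => z * star z).aestronglyMeasurable
    · rw [diagonal_apply_ne _ hij]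
      have h := (hind.indepFun hij).comp (φ := id) (ψ := star) measurable_id
        continuous_star.measurable
      have h2 := h.integral_fun_mul_eq_mul_integral (hm i)
        (continuous_star.comp_aestronglyMeasurable (hm j))
      refine h2.trans ?_
      simp [(hlaw i).integral_eq, integral_id_complexGaussian]

/-- Two families of linear combinations of independent complex Gaussian variables are independent
as soon as they are uncorrelated. Circular symmetry makes the pseudo-covariance vanish. -/
lemma indepFun_mulVec_of_mul_diagonal_mul_eq_zero (hv : ∀ i, 0 ≤ v i)
    (hlaw : ∀ i, HasLaw (ξ i) (complexGaussian (v i)) P) (hind : iIndepFun ξ P)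
    (a : Matrix κ ι ℂ) (b : Matrix κ' ι ℂ)
    (hab : a * diagonal (fun i => (v i : ℂ)) * bᴴ = 0) :
    IndepFun (fun ω => a *ᵥ fun i => ξ i ω) (fun ω => b *ᵥ fun i => ξ i ω) P := by
  have hG : HasGaussianLaw (fun ω i => ξ i ω) P := by
    refine hind.hasGaussianLaw fun i => ⟨?_⟩
    rw [(hlaw i).map_eq]; infer_instance
  let A : (ι → ℂ) →L[ℝ] (κ → ℂ) := (Matrix.mulVecLin a).toContinuousLinearMap.restrictScalars ℝ
  let B : (ι → ℂ) →L[ℝ] (κ' → ℂ) := (Matrix.mulVecLin b).toContinuousLinearMap.restrictScalars ℝ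
  refine HasGaussianLaw.indepFun_of_covariance_strongDual (hG.map (A.prod B)) fun L₁ L₂ => ?_
  obtain ⟨p, hp⟩ := exists_eq_re_dotProduct L₁
  obtain ⟨q, hq⟩ := exists_eq_re_dotProduct L₂
  have h1 : L₁ ∘ (fun ω => a *ᵥ fun i => ξ i ω) = fun ω => ∑ i, ((p ᵥ* a) i * ξ i ω).re := by
    ext ω; rw [Function.comp_apply, hp, dotProduct_mulVec, dotProduct, Complex.re_sum]
  have h2 : L₂ ∘ (fun ω => b *ᵥ fun i => ξ i ω) = fun ω => ∑ i, ((q ᵥ* b) i * ξ i ω).re := by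
    ext ω; rw [Function.comp_apply, hq, dotProduct_mulVec, dotProduct, Complex.re_sum]
  rw [h1, h2]
  have hm : ∀ (u : ℂ) i, MemLp (fun ω => (u * ξ i ω).re) 2 P := fun u i =>
    ((memLp_of_hasLaw_complexGaussian (hlaw i)).const_mul u).re
  have hmean : ∀ (u : ℂ) i, ∫ ω, (u * ξ i ω).re ∂P = 0 := fun u i => by
    refine (integral_re (((memLp_of_hasLaw_complexGaussian (hlaw i)).const_mul u).integrable
      (by norm_num))).trans ?_
    rw [integral_const_mul, (hlaw i).integral_eq, integral_id_complexGaussian]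
    simp
  rw [covariance_fun_sum_fun_sum (fun i => hm _ i) (fun i => hm _ i)]
  have hcov : ∀ i j, cov[fun ω => ((p ᵥ* a) i * ξ i ω).re, fun ω => ((q ᵥ* b) j * ξ j ω).re; P]
      = if i = j then v i / 2 * ((p ᵥ* a) i * star ((q ᵥ* b) i)).re else 0 := by
    intro i j
    split_ifs with hij
    · subst hij
      rw [covariance_eq_sub (hm _ i) (hm _ i), hmean, zero_mul, sub_zero,
        ← integral_re_mul_re_mul_complexGaussian (hv i)]
      exact (hlaw i).integral_comp (f := fun z => ((p ᵥ* a) i * z).re * ((q ᵥ* b) i * z).re)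
        (by fun_prop)
    · exact ((hind.indepFun hij).comp (φ := fun z => ((p ᵥ* a) i * z).re)
        (ψ := fun z => ((q ᵥ* b) j * z).re) (by fun_prop) (by fun_prop)).covariance_eq_zero
        (hm _ i) (hm _ j)
  simp_rw [hcov, Finset.sum_ite_eq, Finset.mem_univ, if_true]
  have h0 : (p ᵥ* (a * diagonal (fun i => (v i : ℂ)) * bᴴ)) ⬝ᵥ star q = 0 := by simp [hab]
  rw [← vecMul_vecMul, ← dotProduct_mulVec, ← star_vecMul, ← vecMul_vecMul] at h0
  have h3 := congrArg (fun z : ℂ => z.re / 2) h0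
  simp only [dotProduct, vecMul_diagonal, Complex.re_sum, Pi.star_apply, Finset.sum_div] at h3
  refine Eq.trans (Finset.sum_congr rfl fun i _ => ?_) (h3.trans (by simp))
  rw [mul_right_comm, Complex.re_mul_ofReal]
  ring

omit [Fintype ι] [DecidableEq ι] [IsProbabilityMeasure P] in
lemma iIndepFun.indepFun_comp_comp {κ κ' : Type*} [Finite κ] [Finite κ'] (hind : iIndepFun ξ P)
    (hm : ∀ i, AEMeasurable (ξ i) P) {f : κ → ι} {g : κ' → ι} (hfg : ∀ i j, f i ≠ g j) :
    IndepFun (fun ω i => ξ (f i) ω) (fun ω j => ξ (g j) ω) P := by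
  classical
  have := Fintype.ofFinite κ
  have := Fintype.ofFinite κ'
  have hd : Disjoint (Finset.univ.image f) (Finset.univ.image g) := by
    rw [Finset.disjoint_left]
    simp only [Finset.mem_image, Finset.mem_univ, true_and]
    rintro _ ⟨i, rfl⟩ ⟨j, h⟩
    exact hfg i j h.symm
  exact (hind.indepFun_finset₀ _ _ hd hm).comp
    (φ := fun x i => x ⟨f i, Finset.mem_image_of_mem f (Finset.mem_univ i)⟩)
    (ψ := fun x j => x ⟨g j, Finset.mem_image_of_mem g (Finset.mem_univ j)⟩)
    (by fun_prop) (by fun_prop)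

/-- Tonelli's theorem for independent random variables. -/
lemma IndepFun.lintegral_comp_prodMk {𝓧 𝓨 : Type*} [MeasurableSpace 𝓧] [MeasurableSpace 𝓨]
    {X : Ω → 𝓧} {Y : Ω → 𝓨} (hX : AEMeasurable X P) (hY : AEMeasurable Y P) (h : IndepFun X Y P)
    {F : 𝓧 → 𝓨 → ℝ≥0∞} (hF : Measurable (Function.uncurry F)) :
    ∫⁻ ω, F (X ω) (Y ω) ∂P = ∫⁻ ω', ∫⁻ ω, F (X ω) (Y ω') ∂P ∂P := by
  have h1 : ∫⁻ ω, F (X ω) (Y ω) ∂P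
      = ∫⁻ z, Function.uncurry F z ∂P.map fun ω => (X ω, Y ω) :=
    (lintegral_map' hF.aemeasurable (hX.prodMk hY)).symm
  rw [h1, (indepFun_iff_map_prod_eq_prod_map_map hX hY).1 h, lintegral_prod_symm' _ hF,
    lintegral_map' hF.lintegral_prod_left'.aemeasurable hY]
  refine lintegral_congr fun ω' => ?_
  exact lintegral_map' (hF.comp measurable_prodMk_right).aemeasurable hX

end family

end ProbabilityTheory

/-! ### Linear estimation in white noise -/

namespace Matrix

variable {m n : Type*} [Fintype m] [Fintype n] [DecidableEq m] [DecidableEq n]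

/-- The covariance matrix of the linear minimum mean squared error estimate of `x` from `A x + z`,
for uncorrelated `x` and `z` with covariance matrices `γ • 1` and `τ • 1`. -/
def estCov (γ τ : ℝ) (A : Matrix m n ℂ) : Matrix n n ℂ :=
  (γ * γ) • (Aᴴ * (γ • (A * Aᴴ) + τ • 1)⁻¹ * A)

/-- The covariance matrix of the error of the same estimate, in information form. -/
def errCov (γ τ : ℝ) (A : Matrix m n ℂ) : Matrix n n ℂ :=
  (γ⁻¹ • 1 + τ⁻¹ • (Aᴴ * A))⁻¹

variable {γ τ γ' τ' : ℝ} (A : Matrix m n ℂ)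

omit [DecidableEq n] in
lemma posDef_smul_mul_conjTranspose_add (hγ : 0 ≤ γ) (hτ : 0 < τ) :
    (γ • (A * Aᴴ) + τ • (1 : Matrix m m ℂ)).PosDef :=
  PosDef.posSemidef_add ((posSemidef_self_mul_conjTranspose A).smul hγ) (PosDef.one.smul hτ)

omit [DecidableEq m] in
lemma posDef_smul_conjTranspose_mul_add (hγ : 0 < γ) (hτ : 0 ≤ τ) :
    (γ • (1 : Matrix n n ℂ) + τ • (Aᴴ * A)).PosDef :=
  (PosDef.one.smul hγ).add_posSemidef ((posSemidef_conjTranspose_mul_self A).smul hτ)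

omit [DecidableEq n] in
lemma wiener_mul_obsCov (hγ : 0 ≤ γ) (hτ : 0 < τ) :
    wiener γ (τ • 1) A * (γ • (A * Aᴴ) + τ • 1) = γ • Aᴴ := by
  have hdet := (isUnit_iff_isUnit_det _).1 (posDef_smul_mul_conjTranspose_add A hγ hτ).isUnit
  rw [wiener, Matrix.smul_mul, Matrix.mul_assoc, nonsing_inv_mul _ hdet, Matrix.mul_one]

/-- The orthogonality principle. -/
lemma one_sub_wiener_mul_mul (hγ : 0 ≤ γ) (hτ : 0 < τ) :
    (1 - wiener γ (τ • 1) A * A) * (γ • Aᴴ) = τ • wiener γ (τ • 1) A := by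
  have h := wiener_mul_obsCov A hγ hτ
  rw [Matrix.mul_add, Matrix.mul_smul, Matrix.mul_smul, Matrix.mul_one, ← Matrix.mul_assoc] at h
  rw [Matrix.sub_mul, Matrix.one_mul, Matrix.mul_smul, ← h]
  abel

lemma errCov_eq (hγ : 0 < γ) (hτ : 0 < τ) :
    errCov γ τ A = γ • (1 - wiener γ (τ • 1) A * A) := by
  refine inv_eq_left_inv ?_
  have h := congrArg (· * A) (one_sub_wiener_mul_mul A hγ.le hτ)
  simp only [Matrix.mul_smul, Matrix.smul_mul, Matrix.mul_assoc] at h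
  rw [Matrix.smul_mul, Matrix.mul_add, smul_add, Matrix.mul_smul, Matrix.mul_one, smul_smul,
    mul_inv_cancel₀ hγ.ne', one_smul, Matrix.mul_smul, smul_comm, h, smul_smul,
    inv_mul_cancel₀ hτ.ne', one_smul, sub_add_cancel]

lemma errCov_eq_add (hγ : 0 < γ) (hτ : 0 < τ) :
    γ • ((1 - wiener γ (τ • 1) A * A) * (1 - wiener γ (τ • 1) A * A)ᴴ)
      + τ • (wiener γ (τ • 1) A * (wiener γ (τ • 1) A)ᴴ) = errCov γ τ A := by
  rw [errCov_eq A hγ hτ, ← Matrix.smul_mul τ, ← one_sub_wiener_mul_mul A hγ.le hτ]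
  simp only [conjTranspose_sub, conjTranspose_one, conjTranspose_mul, Matrix.mul_sub,
    Matrix.mul_one, Matrix.smul_mul, Matrix.mul_smul, Matrix.mul_assoc, smul_sub]
  abel

omit [DecidableEq n] in
lemma conjTranspose_wiener (hγ : 0 ≤ γ) (hτ : 0 < τ) :
    (wiener γ (τ • 1) A)ᴴ = γ • ((γ • (A * Aᴴ) + τ • 1)⁻¹ * A) := by
  have h : ((γ • (A * Aᴴ) + τ • (1 : Matrix m m ℂ))⁻¹)ᴴ = _ :=
    (posDef_smul_mul_conjTranspose_add A hγ hτ).inv.isHermitian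
  rw [wiener, conjTranspose_smul, conjTranspose_mul, h]
  simp

omit [DecidableEq n] in
lemma estCov_eq (hγ : 0 ≤ γ) (hτ : 0 < τ) :
    wiener γ (τ • 1) A * (γ • (A * Aᴴ) + τ • 1) * (wiener γ (τ • 1) A)ᴴ = estCov γ τ A := by
  rw [wiener_mul_obsCov A hγ hτ, conjTranspose_wiener A hγ hτ, estCov, Matrix.smul_mul,
    Matrix.mul_smul, smul_smul, Matrix.mul_assoc]

/-- Push-through identity: the dependence of the Wiener filter on the second order statistics can
be absorbed in a square matrix on the left. -/
lemma exists_mul_wiener_eq (hγ : 0 < γ) (hτ : 0 < τ) (hγ' : 0 < γ') (hτ' : 0 < τ') :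
    ∃ F : Matrix n n ℂ, F * wiener γ' (τ' • 1) A = wiener γ (τ • 1) A := by
  have push : ∀ {γ τ : ℝ}, 0 < γ → 0 < τ →
      (τ • (1 : Matrix n n ℂ) + γ • (Aᴴ * A)) * wiener γ (τ • 1) A = γ • Aᴴ := by
    intro γ τ hγ hτ
    rw [← wiener_mul_obsCov A hγ.le hτ]
    have h1 : (τ • (1 : Matrix n n ℂ) + γ • (Aᴴ * A)) * Aᴴ
        = Aᴴ * (γ • (A * Aᴴ) + τ • 1) := by
      simp only [Matrix.add_mul, Matrix.mul_add, Matrix.smul_mul, Matrix.mul_smul, Matrix.one_mul,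
        Matrix.mul_one, Matrix.mul_assoc]
      abel
    have hdet := (isUnit_iff_isUnit_det _).1
      (posDef_smul_mul_conjTranspose_add A hγ.le hτ).isUnit
    rw [wiener, Matrix.mul_smul, ← Matrix.mul_assoc, h1, Matrix.mul_assoc,
      mul_nonsing_inv _ hdet, Matrix.smul_mul, Matrix.mul_assoc, nonsing_inv_mul _ hdet]
  have hdet := (isUnit_iff_isUnit_det _).1 (posDef_smul_conjTranspose_mul_add A hτ hγ.le).isUnit
  refine ⟨(γ / γ') • ((τ • (1 : Matrix n n ℂ) + γ • (Aᴴ * A))⁻¹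
    * (τ' • (1 : Matrix n n ℂ) + γ' • (Aᴴ * A))), ?_⟩
  rw [Matrix.smul_mul, Matrix.mul_assoc, push hγ' hτ', Matrix.mul_smul, smul_smul,
    div_mul_cancel₀ _ hγ'.ne', ← Matrix.mul_smul, ← push hγ hτ, ← Matrix.mul_assoc,
    nonsing_inv_mul _ hdet, Matrix.one_mul]

variable {c : ℝ}

omit [DecidableEq m] in
lemma posSemidef_errCov_sub (hc : 0 < c) (hγ' : 0 < γ') (hτ' : 0 < τ')
    (h1 : c * γ' ≤ γ) (h2 : c * τ' ≤ τ) :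
    (errCov γ τ A - c • errCov γ' τ' A).PosSemidef := by
  have hγ := (mul_pos hc hγ').trans_le h1
  have hτ := (mul_pos hc hτ').trans_le h2
  have h := (posDef_smul_conjTranspose_mul_add A (inv_pos.2 hγ)
    (inv_pos.2 hτ).le).posSemidef_inv_sub_inv
    (B := c⁻¹ • (γ'⁻¹ • (1 : Matrix n n ℂ) + τ'⁻¹ • (Aᴴ * A))) (by
      have e : c⁻¹ • (γ'⁻¹ • (1 : Matrix n n ℂ) + τ'⁻¹ • (Aᴴ * A))
          - (γ⁻¹ • (1 : Matrix n n ℂ) + τ⁻¹ • (Aᴴ * A))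
          = ((c * γ')⁻¹ - γ⁻¹) • (1 : Matrix n n ℂ) + ((c * τ')⁻¹ - τ⁻¹) • (Aᴴ * A) := by
        simp only [smul_add, smul_smul, sub_smul, mul_inv]
        abel
      rw [e]
      exact (PosSemidef.one.smul (sub_nonneg.2 (inv_anti₀ (mul_pos hc hγ') h1))).add
        ((posSemidef_conjTranspose_mul_self A).smul
          (sub_nonneg.2 (inv_anti₀ (mul_pos hc hτ') h2))))
  have e : (c⁻¹ • (γ'⁻¹ • (1 : Matrix n n ℂ) + τ'⁻¹ • (Aᴴ * A)))⁻¹ = c • errCov γ' τ' A := by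
    have hdet := (isUnit_iff_isUnit_det _).1
      (posDef_smul_conjTranspose_mul_add A (inv_pos.2 hγ') (inv_pos.2 hτ').le).isUnit
    refine inv_eq_left_inv ?_
    rw [errCov, Matrix.smul_mul, Matrix.mul_smul, nonsing_inv_mul _ hdet, smul_smul,
      mul_inv_cancel₀ hc.ne', one_smul]
  rwa [e] at h

omit [DecidableEq n] in
lemma posSemidef_estCov_sub (hc : 0 < c) (hγ' : 0 < γ') (hτ' : 0 < τ')
    (h1 : c * γ' ≤ γ) (h2 : c * τ' ≤ τ) :
    ((γ ^ 2 / (c * γ' ^ 2)) • estCov γ' τ' A - estCov γ τ A).PosSemidef := by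
  have hpd := posDef_smul_mul_conjTranspose_add A hγ'.le hτ'
  have h := (hpd.smul hc).posSemidef_inv_sub_inv (B := γ • (A * Aᴴ) + τ • 1) (by
      have e : γ • (A * Aᴴ) + τ • 1 - c • (γ' • (A * Aᴴ) + τ' • (1 : Matrix m m ℂ))
          = (γ - c * γ') • (A * Aᴴ) + (τ - c * τ') • (1 : Matrix m m ℂ) := by
        simp only [smul_add, smul_smul, sub_smul]
        abel
      rw [e]
      exact ((posSemidef_self_mul_conjTranspose A).smul (sub_nonneg.2 h1)).add
        (PosSemidef.one.smul (sub_nonneg.2 h2)))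
  have e : (c • (γ' • (A * Aᴴ) + τ' • (1 : Matrix m m ℂ)))⁻¹
      = c⁻¹ • (γ' • (A * Aᴴ) + τ' • (1 : Matrix m m ℂ))⁻¹ := by
    have hdet := (isUnit_iff_isUnit_det _).1 hpd.isUnit
    refine inv_eq_left_inv ?_
    rw [Matrix.smul_mul, Matrix.mul_smul, nonsing_inv_mul _ hdet, smul_smul,
      inv_mul_cancel₀ hc.ne', one_smul]
  rw [e] at h
  have h3 := (h.conjTranspose_mul_mul_same A).smul (mul_self_nonneg γ)
  convert h3 using 1
  simp only [estCov, Matrix.mul_sub, Matrix.sub_mul, smul_sub, smul_smul, Matrix.mul_smul,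
    Matrix.smul_mul]
  congr 2
  field_simp

end Matrix

namespace ProbabilityTheory

variable {Ω : Type*} [MeasurableSpace Ω] {P : Measure Ω}
variable {m n : Type*} [Fintype m] [Fintype n]

/-! ### Expectations of random matrices -/

lemma integrable_trace_mul {X : Ω → Matrix m n ℂ} (hX : ∀ i j, Integrable (fun ω => X ω i j) P)
    (Y : Matrix n m ℂ) : Integrable (fun ω => (Y * X ω).trace) P := by
  simp only [Matrix.trace, Matrix.diag_apply, Matrix.mul_apply]
  exact integrable_finsetSum _ fun i _ => integrable_finsetSum _ fun j _ => (hX j i).const_mul _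

lemma integral_trace_mul {X : Ω → Matrix m n ℂ} (hX : ∀ i j, Integrable (fun ω => X ω i j) P)
    {X' : Matrix m n ℂ} (hX' : ∀ i j, ∫ ω, X ω i j ∂P = X' i j) (Y : Matrix n m ℂ) :
    ∫ ω, (Y * X ω).trace ∂P = (Y * X').trace := by
  simp only [Matrix.trace, Matrix.diag_apply, Matrix.mul_apply]
  refine (integral_finsetSum _ fun i _ =>
    integrable_finsetSum _ fun j _ => (hX j i).const_mul (Y i j)).trans ?_
  refine Finset.sum_congr rfl fun i _ => ?_
  refine (integral_finsetSum _ fun j _ => (hX j i).const_mul (Y i j)).trans ?_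
  exact Finset.sum_congr rfl fun j _ => by rw [integral_const_mul, hX']

variable [DecidableEq m] [DecidableEq n] [IsProbabilityMeasure P]

omit [DecidableEq m] in
/-- A centred independent perturbation of the observation matrix acts like additional noise. -/
lemma lintegral_risk_add {β : ℝ} (hβ : 0 ≤ β) {L : Matrix m m ℂ} (hL : L.PosSemidef)
    (U : Matrix m n ℂ) (W : Matrix n m ℂ) {X : Ω → Matrix m n ℂ} {C : Matrix m m ℂ}
    (hX : ∀ i j, Integrable (fun ω => X ω i j) P) (hX0 : ∀ i j, ∫ ω, X ω i j ∂P = 0)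
    (hXX : ∀ i j, Integrable (fun ω => (X ω * (X ω)ᴴ) i j) P)
    (hC : ∀ i j, ∫ ω, (X ω * (X ω)ᴴ) i j ∂P = C i j) :
    ∫⁻ ω, ENNReal.ofReal (risk β L (U + X ω) W) ∂P = ENNReal.ofReal (risk β (L + β • C) U W) := by
  have key : ∀ ω, risk β L (U + X ω) W = risk β L U W + β * (Wᴴ * W * (X ω * (X ω)ᴴ)).trace.re
      - 2 * β * ((1 - W * U)ᴴ * W * X ω).trace.re := by
    intro ω
    have h1 : β • ((1 - W * (U + X ω)) * (1 - W * (U + X ω))ᴴ) + W * L * Wᴴ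
        = (β • ((1 - W * U) * (1 - W * U)ᴴ) + W * L * Wᴴ)
          + β • (W * (X ω * (X ω)ᴴ) * Wᴴ) - β • (W * X ω * (1 - W * U)ᴴ)
          - β • (W * X ω * (1 - W * U)ᴴ)ᴴ := by
      have : 1 - W * (U + X ω) = (1 - W * U) - W * X ω := by
        rw [Matrix.mul_add]; abel
      rw [this]
      generalize 1 - W * U = E
      simp only [conjTranspose_sub, conjTranspose_mul, conjTranspose_conjTranspose, Matrix.sub_mul,
        Matrix.mul_sub, Matrix.mul_assoc, smul_sub]
      abel
    have h2 : (W * (X ω * (X ω)ᴴ) * Wᴴ).trace = (Wᴴ * W * (X ω * (X ω)ᴴ)).trace := by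
      rw [Matrix.trace_mul_comm, Matrix.mul_assoc Wᴴ]
    have h3 : (W * X ω * (1 - W * U)ᴴ).trace = ((1 - W * U)ᴴ * W * X ω).trace := by
      rw [Matrix.trace_mul_comm, Matrix.mul_assoc]
    unfold risk
    rw [h1, trace_sub, trace_sub, trace_add _ (β • _), trace_smul, trace_smul, trace_smul,
      trace_conjTranspose, h2, h3]
    simp only [Complex.sub_re, Complex.add_re, Complex.real_smul, Complex.re_ofReal_mul,
      Complex.star_def, Complex.conj_re]
    ring
  have i1 : Integrable (fun ω => β * (Wᴴ * W * (X ω * (X ω)ᴴ)).trace.re) P :=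
    (integrable_trace_mul hXX (Wᴴ * W)).re.const_mul β
  have i2 : Integrable (fun ω => 2 * β * ((1 - W * U)ᴴ * W * X ω).trace.re) P :=
    (integrable_trace_mul hX ((1 - W * U)ᴴ * W)).re.const_mul (2 * β)
  have i3 : Integrable (fun ω => risk β L U W + β * (Wᴴ * W * (X ω * (X ω)ᴴ)).trace.re) P :=
    (integrable_const _).add i1
  have hint : Integrable (fun ω => risk β L (U + X ω) W) P := by
    simp_rw [key]
    exact i3.sub i2
  rw [← ofReal_integral_eq_lintegral_ofReal hint
    (Filter.Eventually.of_forall fun ω => risk_nonneg hβ hL _ _)]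
  congr 1
  simp_rw [key]
  have e1 : ∫ ω, β * (Wᴴ * W * (X ω * (X ω)ᴴ)).trace.re ∂P = β * (Wᴴ * W * C).trace.re := by
    rw [integral_const_mul, ← integral_trace_mul hXX hC]
    exact congrArg _ (integral_re (integrable_trace_mul hXX (Wᴴ * W)))
  have e2 : ∫ ω, 2 * β * ((1 - W * U)ᴴ * W * X ω).trace.re ∂P = 0 := by
    have h0 := integral_trace_mul (X' := 0) hX (by simpa using hX0) ((1 - W * U)ᴴ * W)
    have := integral_re (integrable_trace_mul hX ((1 - W * U)ᴴ * W))
    rw [h0] at this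
    rw [integral_const_mul]
    simpa using Or.inr this
  rw [integral_sub i3 i2, integral_add (integrable_const _) i1, e1, e2]
  unfold risk
  have h2 : (W * C * Wᴴ).trace = (Wᴴ * W * C).trace := by
    rw [Matrix.trace_mul_comm, Matrix.mul_assoc]
  rw [Matrix.mul_add, Matrix.add_mul, Matrix.mul_smul, Matrix.smul_mul, ← add_assoc,
    trace_add _ (β • _), trace_smul, h2]
  simp

end ProbabilityTheory

/-! ### The closed form -/

namespace HRISSystem

variable {M N K Nr T B : ℕ} (s : HRISSystem M N K Nr T B)

/-- The total path gain `∑ γ_k`, so that `R_G = s.gain • 1`. -/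
def gain : ℝ := ∑ k, s.γ k

/-- The noise variance `(T Γ)⁻¹` after projection on the pilots. -/
def noiseVar : ℝ := ((T : ℝ) * s.Γ)⁻¹

/-- The reflection coefficients: row `b` is the diagonal of `Ψ(b)`. -/
def refl : Matrix (Fin B) (Fin N) ℂ := Matrix.of fun b l => s.Psi b l l

/-- The `B × B` matrix `Λ` with `D(Ω) = Λ ⊗ I_K`. -/
def lam : Matrix (Fin B) (Fin B) ℂ :=
  s.noiseVar • 1 + s.refl * diagonal (fun l => ((s.β / K : ℝ) : ℂ) * s.RGerr l l) * s.reflᴴ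

/-- The linear map `S ↦ (∑ᵢⱼ Λ⁻¹ⱼᵢ Ψ(i) S Ψ(j)ᴴ)ᵀ` that turns a covariance matrix of channel
estimates into information about a row of `H`. -/
def infoMap (S : Matrix (Fin N) (Fin N) ℂ) : Matrix (Fin N) (Fin N) ℂ :=
  (∑ j, ∑ i, (s.lam)⁻¹ j i • (s.Psi i * S * (s.Psi j)ᴴ))ᵀ

/-- The `N × N` matrix `J` with `s.infoH = J ⊗ I_M`. -/
def infoRow : Matrix (Fin N) (Fin N) ℂ :=
  s.β⁻¹ • 1 + ((K : ℝ) ^ 2) • s.infoMap s.Sigma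

lemma gain_pos (hK : 0 < K) : 0 < s.gain :=
  have : Nonempty (Fin K) := ⟨⟨0, hK⟩⟩
  Finset.sum_pos (fun k _ => s.γ_pos k) Finset.univ_nonempty

lemma gain_ge (k : Fin K) : s.γ k ≤ s.gain :=
  Finset.single_le_sum (fun k _ => (s.γ_pos k).le) (Finset.mem_univ k)

lemma noiseVar_pos (hT : 0 < T) : 0 < s.noiseVar :=
  inv_pos.2 (mul_pos (Nat.cast_pos.2 hT) (div_pos s.Pt_pos s.σsq_pos))

lemma RG_eq : s.RG = s.gain • 1 := by
  rw [RG, Complex.coe_smul, gain]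

lemma Rrc_eq : s.Rrc = s.gain • (s.Arc * s.Arcᴴ) + (K * s.noiseVar) • 1 := by
  rw [Rrc, RG_eq, Complex.coe_smul, noiseVar]
  simp

lemma Mo_eq : s.Mo = wiener s.gain ((K * s.noiseVar) • 1) s.Arc := by
  rw [Mo, Rrc_eq, RG_eq, wiener]
  simp

lemma Sigma_eq : s.Sigma = estCov s.gain (K * s.noiseVar) s.Arc := by
  rw [Sigma, Rrc_eq, RG_eq, estCov]
  simp [smul_smul, Matrix.mul_assoc]

lemma RGerr_eq (hK : 0 < K) : s.RGerr = errCov s.gain (K * s.noiseVar) s.Arc := by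
  have hg := (s.gain_pos hK).ne'
  have : (s.gain • (1 : Matrix (Fin N) (Fin N) ℂ))⁻¹ = s.gain⁻¹ • 1 :=
    inv_eq_left_inv (by simp [smul_smul, hg])
  rw [RGerr, RG_eq, this, errCov, Complex.coe_smul, noiseVar, mul_inv, inv_inv,
    mul_comm (K : ℝ)⁻¹]

lemma Psi_eq (b : Fin B) : s.Psi b = diagonal (s.refl b) := by
  ext i j
  by_cases h : i = j <;> simp [Psi, refl, h]

lemma trace_Psi_mul_Psi (i j : Fin B) (R : Matrix (Fin N) (Fin N) ℂ) :
    ((s.Psi j)ᴴ * s.Psi i * R).trace = ∑ l, star (s.refl j l) * s.refl i l * R l l := by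
  simp [Psi_eq, diagonal_conjTranspose, Matrix.trace]

lemma posDef_RGerr (hK : 0 < K) (hT : 0 < T) : s.RGerr.PosDef := by
  rw [RGerr_eq s hK]
  exact (posDef_smul_conjTranspose_mul_add _ (inv_pos.2 (s.gain_pos hK)) (inv_pos.2
    (mul_pos (Nat.cast_pos.2 hK) (s.noiseVar_pos hT))).le).inv

lemma posDef_lam (hK : 0 < K) (hT : 0 < T) : s.lam.PosDef := by
  refine (PosDef.one.smul (s.noiseVar_pos hT)).add_posSemidef
    ((PosSemidef.diagonal fun l => ?_).mul_mul_conjTranspose_same _)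
  exact mul_nonneg (Complex.zero_le_real.2 (div_nonneg s.β_pos.le (Nat.cast_nonneg _)))
    (s.posDef_RGerr hK hT).posSemidef.diag_nonneg

lemma D_eq : s.D = s.lam ⊗ₖ 1 := by
  ext ⟨i, k⟩ ⟨j, k'⟩
  have h : (s.refl * diagonal (fun l => ((s.β / K : ℝ) : ℂ) * s.RGerr l l) * s.reflᴴ) i j
      = ((s.β / K : ℝ) : ℂ) * ((s.Psi j)ᴴ * s.Psi i * s.RGerr).trace := by
    rw [trace_Psi_mul_Psi, Matrix.mul_apply, Finset.mul_sum]
    refine Finset.sum_congr rfl fun l _ => ?_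
    rw [mul_diagonal, conjTranspose_apply]
    ring
  rw [D, Matrix.of_apply, kroneckerMap_apply, lam, Matrix.add_apply, h, DBlock]
  by_cases hij : i = j
  · subst hij
    simp only [if_true, Matrix.add_apply, Matrix.smul_apply, Matrix.one_apply_eq, noiseVar,
      smul_eq_mul, Complex.real_smul]
    ring
  · simp [hij]

lemma posDef_D (hK : 0 < K) (hT : 0 < T) : s.D.PosDef := by
  rw [D_eq]
  exact (s.posDef_lam hK hT).kronecker PosDef.one

lemma posSemidef_Sigma (hK : 0 < K) (hT : 0 < T) : s.Sigma.PosSemidef := by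
  rw [Sigma_eq, estCov]
  exact ((posDef_smul_mul_conjTranspose_add _ (s.gain_pos hK).le
    (mul_pos (Nat.cast_pos.2 hK) (s.noiseVar_pos hT))).inv.posSemidef.conjTranspose_mul_mul_same
      _).smul (mul_self_nonneg _)

lemma posSemidef_infoMap (hK : 0 < K) (hT : 0 < T) {S : Matrix (Fin N) (Fin N) ℂ}
    (hS : S.PosSemidef) : (s.infoMap S).PosSemidef :=
  (posSemidef_sum_sum_smul (s.posDef_lam hK hT).inv.posSemidef hS s.Psi).transpose

lemma posDef_infoRow (hK : 0 < K) (hT : 0 < T) : s.infoRow.PosDef :=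
  (PosDef.one.smul (inv_pos.2 s.β_pos)).add_posSemidef
    ((s.posSemidef_infoMap hK hT (s.posSemidef_Sigma hK hT)).smul (by positivity))

lemma infoMap_sub (S S' : Matrix (Fin N) (Fin N) ℂ) :
    s.infoMap (S - S') = s.infoMap S - s.infoMap S' := by
  simp only [infoMap, Matrix.mul_sub, Matrix.sub_mul, smul_sub, Finset.sum_sub_distrib,
    transpose_sub]

lemma infoMap_smul (r : ℝ) (S : Matrix (Fin N) (Fin N) ℂ) :
    s.infoMap (r • S) = r • s.infoMap S := by
  simp only [infoMap, Matrix.mul_smul, Matrix.smul_mul, Finset.smul_sum, ← transpose_smul,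
    smul_comm r]

lemma trace_DinvTBlock (i j : Fin B) : (s.DinvTBlock i j).trace = K * (s.lam)⁻¹ j i := by
  simp [DinvTBlock, D_eq, inv_kronecker, Matrix.trace]

lemma infoH_eq : s.infoH = s.infoRow ⊗ₖ 1 := by
  rw [infoH, infoRow, add_kronecker, infoMap]
  congr 1
  · rw [Complex.coe_smul, smul_kronecker, one_kronecker_one]
  · congr 1
    simp only [trace_DinvTBlock, ← transpose_smul, Finset.smul_sum]
    congr 1
    refine Finset.sum_congr rfl fun j _ => Finset.sum_congr rfl fun i _ => ?_
    rw [← Complex.coe_smul, smul_smul, smul_smul]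
    congr 1
    push_cast
    ring

lemma posDef_infoH (hK : 0 < K) (hT : 0 < T) : s.infoH.PosDef := by
  rw [infoH_eq]
  exact (s.posDef_infoRow hK hT).kronecker PosDef.one

lemma EH_im (hK : 0 < K) (hT : 0 < T) : s.EH.im = 0 :=
  (Complex.nonneg_iff.1 (s.posDef_infoH hK hT).inv.posSemidef.trace_nonneg).2.symm

/-- The conditional covariance matrix, given the signal at the surface, of the part of the signal
at the base station that the surface does not resolve, in the `(b, k)` coordinates. -/
def condCov : Matrix (Fin B × Fin K) (Fin B × Fin K) ℂ :=
  (s.refl ⊗ₖ (1 : Matrix (Fin K) (Fin K) ℂ))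
    * diagonal (fun p : Fin N × Fin K => errCov (s.γ p.2) s.noiseVar s.Arc p.1 p.1)
    * (s.refl ⊗ₖ (1 : Matrix (Fin K) (Fin K) ℂ))ᴴ

/-- The share of user `k` in the total path gain. -/
def share (k : Fin K) : ℝ := s.γ k / s.gain

lemma share_pos (hK : 0 < K) (k : Fin K) : 0 < s.share k :=
  div_pos (s.γ_pos k) (s.gain_pos hK)

lemma share_le_one (hK : 0 < K) (k : Fin K) : s.share k ≤ 1 :=
  (div_le_one (s.gain_pos hK)).2 (s.gain_ge k)

lemma share_div_mul_gain_le (hK : 0 < K) (k : Fin K) : s.share k / K * s.gain ≤ s.γ k := by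
  have hK1 : (1 : ℝ) ≤ K := Nat.one_le_cast.2 hK
  rw [share, div_mul_eq_mul_div, div_mul_cancel₀ _ (s.gain_pos hK).ne']
  exact div_le_self (s.γ_pos k).le hK1

lemma share_div_mul_noiseVar_le (hK : 0 < K) (hT : 0 < T) (k : Fin K) :
    s.share k / K * (K * s.noiseVar) ≤ s.noiseVar := by
  have hK1 : (K : ℝ) ≠ 0 := (Nat.cast_pos.2 hK).ne'
  rw [← mul_assoc, div_mul_cancel₀ _ hK1]
  exact mul_le_of_le_one_left (s.noiseVar_pos hT).le (s.share_le_one hK k)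

lemma posSemidef_condCov (hT : 0 < T) : s.condCov.PosSemidef := by
  refine (PosSemidef.diagonal fun p => ?_).mul_mul_conjTranspose_same _
  have h : (errCov (s.γ p.2) s.noiseVar s.Arc).PosDef :=
    (posDef_smul_conjTranspose_mul_add _ (inv_pos.2 (s.γ_pos p.2))
      (inv_pos.2 (s.noiseVar_pos hT)).le).inv
  exact h.posSemidef.diag_nonneg

/-- Lower bound for the effective noise: for each user, the error covariance for path gain `γ_k` and
noise variance `τ` dominates `s_k / K` times the one for path gain `∑ γ` and noise variance `K τ`,
which is `R_G̃`. -/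
lemma posSemidef_condCov_sub (hK : 0 < K) (hT : 0 < T) :
    (s.noiseVar • 1 + s.β • s.condCov
      - s.lam ⊗ₖ diagonal fun k => (s.share k : ℂ)).PosSemidef := by
  set X : Matrix (Fin B × Fin K) (Fin N × Fin K) ℂ :=
    s.refl ⊗ₖ (1 : Matrix (Fin K) (Fin K) ℂ) with hX
  have hτ := s.noiseVar_pos hT
  have e1 : s.lam ⊗ₖ (diagonal fun k => (s.share k : ℂ))
      = s.noiseVar • ((1 : Matrix (Fin B) (Fin B) ℂ) ⊗ₖ diagonal fun k => (s.share k : ℂ))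
        + X * ((diagonal fun l => ((s.β / K : ℝ) : ℂ) * s.RGerr l l)
          ⊗ₖ diagonal fun k => (s.share k : ℂ)) * Xᴴ := by
    rw [hX, conjTranspose_kronecker, ← mul_kronecker_mul, ← mul_kronecker_mul, lam, add_kronecker,
      smul_kronecker]
    simp
  have e2 : s.noiseVar • 1 + s.β • s.condCov - s.lam ⊗ₖ (diagonal fun k => (s.share k : ℂ))
      = s.noiseVar • (diagonal fun p : Fin B × Fin K => ((1 - s.share p.2 : ℝ) : ℂ))
        + X * (diagonal fun p : Fin N × Fin K => (s.β : ℂ) *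
          (errCov (s.γ p.2) s.noiseVar s.Arc - (s.share p.2 / K) • s.RGerr) p.1 p.1) * Xᴴ := by
    have d1 : (diagonal fun p : Fin B × Fin K => ((1 - s.share p.2 : ℝ) : ℂ))
        = 1 - (1 : Matrix (Fin B) (Fin B) ℂ) ⊗ₖ diagonal fun k => (s.share k : ℂ) := by
      have h1 : (1 : Matrix (Fin B) (Fin B) ℂ) = diagonal fun _ => 1 := diagonal_one.symm
      have h2 : (1 : Matrix (Fin B × Fin K) (Fin B × Fin K) ℂ) = diagonal fun _ => 1 :=
        diagonal_one.symm
      rw [h1, diagonal_kronecker_diagonal, h2, diagonal_sub]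
      simp
    have d2 : (diagonal fun p : Fin N × Fin K => (s.β : ℂ) *
          (errCov (s.γ p.2) s.noiseVar s.Arc - (s.share p.2 / K) • s.RGerr) p.1 p.1)
        = s.β • (diagonal fun p : Fin N × Fin K => errCov (s.γ p.2) s.noiseVar s.Arc p.1 p.1)
          - (diagonal fun l => ((s.β / K : ℝ) : ℂ) * s.RGerr l l)
            ⊗ₖ diagonal fun k => (s.share k : ℂ) := by
      rw [diagonal_kronecker_diagonal, ← diagonal_smul, diagonal_sub]
      congr 1
      ext p
      simp only [Matrix.sub_apply, Matrix.smul_apply, Pi.smul_apply, Complex.real_smul]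
      push_cast
      ring
    rw [e1, d1, d2, condCov, ← hX]
    simp only [Matrix.mul_sub, Matrix.sub_mul, Matrix.mul_smul, Matrix.smul_mul, smul_sub]
    abel
  rw [e2]
  refine ((PosSemidef.diagonal fun p => ?_).smul hτ.le).add
    ((PosSemidef.diagonal fun p => ?_).mul_mul_conjTranspose_same X)
  · exact Complex.zero_le_real.2 (sub_nonneg.2 (s.share_le_one hK p.2))
  · refine mul_nonneg (Complex.zero_le_real.2 s.β_pos.le) (PosSemidef.diag_nonneg ?_)
    rw [s.RGerr_eq hK]
    exact posSemidef_errCov_sub _ (div_pos (s.share_pos hK _) (Nat.cast_pos.2 hK))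
      (s.gain_pos hK) (mul_pos (Nat.cast_pos.2 hK) hτ) (s.share_div_mul_gain_le hK _)
      (s.share_div_mul_noiseVar_le hK hT _)

/-- The expected information gained from the estimates of the users, weighted as in
`posSemidef_condCov_sub`, is at most the information in the closed form. The factor `K ^ 2` of the
latter makes up for unequal path gains. -/
lemma posSemidef_infoMap_sub_sum (hK : 0 < K) (hT : 0 < T) :
    ((K : ℝ) ^ 2 • s.infoMap s.Sigma
      - ∑ k, (s.share k)⁻¹ • s.infoMap (estCov (s.γ k) s.noiseVar s.Arc)).PosSemidef := by
  have e : (K : ℝ) ^ 2 • s.infoMap s.Sigma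
      - ∑ k, (s.share k)⁻¹ • s.infoMap (estCov (s.γ k) s.noiseVar s.Arc)
      = ∑ k, (s.share k)⁻¹ • s.infoMap ((s.share k * K) • s.Sigma
        - estCov (s.γ k) s.noiseVar s.Arc) := by
    simp only [infoMap_sub, infoMap_smul, smul_sub, Finset.sum_sub_distrib, smul_smul,
      inv_mul_cancel_left₀ (s.share_pos hK _).ne']
    simp [sq, ← Nat.cast_smul_eq_nsmul ℝ, smul_smul]
  rw [e]
  -- The weight `s_k⁻¹` of user `k` leaves the factor `K` for each of the `K` users.
  refine posSemidef_sum _ fun k _ => PosSemidef.smul (s.posSemidef_infoMap hK hT ?_)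
    (inv_pos.2 (s.share_pos hK k)).le
  have h := posSemidef_estCov_sub s.Arc (div_pos (s.share_pos hK k) (Nat.cast_pos.2 hK))
      (s.gain_pos hK) (mul_pos (Nat.cast_pos.2 hK) (s.noiseVar_pos hT))
      (s.share_div_mul_gain_le hK k) (s.share_div_mul_noiseVar_le hK hT k)
  rw [← Sigma_eq] at h
  convert h using 3
  have hg := (s.gain_pos hK).ne'
  have hγ := (s.γ_pos k).ne'
  have hK1 : (K : ℝ) ≠ 0 := (Nat.cast_pos.2 hK).ne'
  rw [share]
  field_simp

end HRISSystem

/-! ### Measurability of matrix operations -/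

namespace Matrix

variable {Z : Type*} [MeasurableSpace Z] {m n o : Type*} [Fintype m] [Fintype n] [Fintype o]
  [DecidableEq m] [DecidableEq n]

omit [Fintype m] [Fintype o] [DecidableEq m] [DecidableEq n] in
lemma measurable_mul_apply {A : Z → Matrix m n ℂ} {B : Z → Matrix n o ℂ}
    (hA : ∀ i j, Measurable fun z => A z i j) (hB : ∀ i j, Measurable fun z => B z i j) (i j) :
    Measurable fun z => (A z * B z) i j := by
  simp only [Matrix.mul_apply]
  exact Finset.measurable_fun_sum _ fun k _ => (hA i k).mul (hB k j)

omit [Fintype m] [Fintype n] [DecidableEq m] [DecidableEq n] in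
lemma measurable_conjTranspose_apply {A : Z → Matrix m n ℂ}
    (hA : ∀ i j, Measurable fun z => A z i j) (i j) : Measurable fun z => (A z)ᴴ i j :=
  continuous_star.measurable.comp (hA j i)

lemma measurable_det {A : Z → Matrix m m ℂ} (hA : ∀ i j, Measurable fun z => A z i j) :
    Measurable fun z => (A z).det := by
  simp only [det_apply]
  exact Finset.measurable_fun_sum _ fun σ _ =>
    (Finset.measurable_fun_prod _ fun i _ => hA _ _).const_smul _

lemma measurable_inv_apply {A : Z → Matrix m m ℂ} (hA : ∀ i j, Measurable fun z => A z i j)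
    (i j) : Measurable fun z => (A z)⁻¹ i j := by
  simp only [inv_def, Matrix.smul_apply, Ring.inverse_eq_inv', smul_eq_mul, adjugate_apply]
  refine (measurable_det hA).inv.mul (measurable_det fun k l => ?_)
  by_cases h : k = j
  · subst h; simp
  · simpa [updateRow_ne h] using hA k l

omit [DecidableEq m] in
lemma measurable_risk (β : ℝ) (L : Matrix m m ℂ) {U : Z → Matrix m n ℂ} {W : Z → Matrix n m ℂ}
    (hU : ∀ i j, Measurable fun z => U z i j) (hW : ∀ i j, Measurable fun z => W z i j) :
    Measurable fun z => risk β L (U z) (W z) := by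
  have h1 : ∀ i j, Measurable fun z => ((1 : Matrix n n ℂ) - W z * U z) i j := fun i j =>
    (measurable_const (a := (1 : Matrix n n ℂ) i j)).sub (measurable_mul_apply hW hU i j)
  have h2 := measurable_mul_apply h1 (measurable_conjTranspose_apply h1)
  have h3 := measurable_mul_apply (measurable_mul_apply hW (B := fun _ => L)
    fun _ _ => measurable_const) (measurable_conjTranspose_apply hW)
  refine Complex.measurable_re.comp (Finset.measurable_fun_sum _ fun i _ => ?_)
  exact ((h2 i i).const_smul β).add (h3 i i)

omit [DecidableEq n] in
lemma measurable_wiener_apply (β : ℝ) (L : Matrix m m ℂ) {U : Z → Matrix m n ℂ}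
    (hU : ∀ i j, Measurable fun z => U z i j) (i j) :
    Measurable fun z => wiener β L (U z) i j := by
  have h1 := measurable_mul_apply hU (measurable_conjTranspose_apply hU)
  have h2 : ∀ i j, Measurable fun z => (β • (U z * (U z)ᴴ) + L) i j := fun i j =>
    ((h1 i j).const_smul β).add measurable_const
  exact (measurable_mul_apply (measurable_conjTranspose_apply hU)
    (measurable_inv_apply h2) i j).const_smul β

end Matrix

namespace HRISSystem

variable {M N K Nr T B : ℕ} (s : HRISSystem M N K Nr T B)

/-! ### Observations as linear images of independent variables -/

/-- The factor `(T √P_t)⁻¹` of the projection on the pilots. -/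
def pilotScale : ℝ := ((T : ℝ) * √s.Pt)⁻¹

lemma pilotScale_mul_sqrt_mul (hT : 0 < T) : s.pilotScale * √s.Pt * T = 1 := by
  have h1 : (T : ℝ) ≠ 0 := (Nat.cast_pos.2 hT).ne'
  have h2 : √s.Pt ≠ 0 := (Real.sqrt_pos.2 s.Pt_pos).ne'
  rw [pilotScale]; field_simp

lemma pilotScale_sq_mul (hT : 0 < T) :
    s.pilotScale * s.pilotScale * s.σsq * T = s.noiseVar := by
  have h1 : (T : ℝ) ≠ 0 := (Nat.cast_pos.2 hT).ne'
  have h2 : √s.Pt * √s.Pt = s.Pt := Real.mul_self_sqrt s.Pt_pos.le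
  have h3 := s.Pt_pos.ne'
  have h4 := s.σsq_pos.ne'
  rw [pilotScale, noiseVar, HRISSystem.Γ, mul_inv, mul_mul_mul_comm, ← mul_inv, ← mul_inv, h2]
  field_simp

lemma sum_S_mul_star (k k' : Fin K) :
    ∑ t, s.S k t * star (s.S k' t) = if k = k' then (T : ℂ) else 0 := by
  have := congrFun (congrFun s.S_orth k) k'
  simpa [Matrix.mul_apply, Matrix.one_apply] using this

/-- The projection on the pilots turns white noise of variance `σ²` into white noise of variance
`(T Γ)⁻¹`. -/
lemma sum_pilot_mul_star (hT : 0 < T) (k k' : Fin K) :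
    ∑ t, (s.pilotScale : ℂ) * star (s.S k t) * s.σsq * star ((s.pilotScale : ℂ) * star (s.S k' t))
      = if k = k' then (s.noiseVar : ℂ) else 0 := by
  have h := s.sum_S_mul_star k' k
  have : ∀ t, (s.pilotScale : ℂ) * star (s.S k t) * s.σsq
      * star ((s.pilotScale : ℂ) * star (s.S k' t))
      = ((s.pilotScale * s.pilotScale * s.σsq : ℝ) : ℂ) * (s.S k' t * star (s.S k t)) := by
    intro t
    simp only [star_mul', Complex.star_def, Complex.conj_ofReal, Complex.conj_conj]
    push_cast
    ring
  simp_rw [this, ← Finset.mul_sum, h, ← s.pilotScale_sq_mul hT, eq_comm (a := k)]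
  split_ifs <;> simp

/-- The coefficients of the user channels and of the projected noise at the surface, indexed by
`(l, k)` and `((b, r), k)`, in terms of the user channels and of the raw noise. -/
def coefRC : Matrix ((Fin N ⊕ (Fin B × Fin Nr)) × Fin K)
    ((Fin N × Fin K) ⊕ (Fin B × Fin Nr × Fin T)) ℂ :=
  Matrix.of fun p => Sum.elim (fun q => if p = (Sum.inl q.1, q.2) then 1 else 0)
    (fun q => if p.1 = Sum.inr (q.1, q.2.1) then (s.pilotScale : ℂ) * star (s.S p.2 q.2.2) else 0)

/-- The variances of the entries of the user channels and of the noise at the surface. -/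
def varRC : (Fin N × Fin K) ⊕ (Fin B × Fin Nr × Fin T) → ℝ :=
  Sum.elim (fun p => s.γ p.2) (fun _ => s.σsq)

/-- The coefficients of `vec H` and of the projected noise at the base station in terms of `H` and
of the raw noise. -/
def coefBS : Matrix ((Fin N × Fin M) ⊕ ((Fin B × Fin K) × Fin M))
    ((Fin M × Fin N) ⊕ (Fin B × Fin M × Fin T)) ℂ :=
  Matrix.of <| Sum.elim (fun p => Sum.elim (fun q => if p = (q.2, q.1) then 1 else 0) fun _ => 0)
    (fun p => Sum.elim (fun _ => 0) fun q =>
      if (p.1.1, p.2) = (q.1, q.2.1) then (s.pilotScale : ℂ) * star (s.S p.1.2 q.2.2) else 0)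

/-- The variances of the entries of `H` and of the noise at the base station. -/
def varBS : (Fin M × Fin N) ⊕ (Fin B × Fin M × Fin T) → ℝ :=
  Sum.elim (fun _ => s.β) (fun _ => s.σsq)

lemma coefRC_mul_diagonal_mul (hT : 0 < T) :
    s.coefRC * diagonal (fun i => (s.varRC i : ℂ)) * s.coefRCᴴ
      = blockDiagonal fun k => fromBlocks (s.γ k • 1) 0 0 (s.noiseVar • 1) := by
  ext ⟨i, k⟩ ⟨i', k'⟩
  rw [Matrix.mul_apply]
  simp only [mul_diagonal, conjTranspose_apply, Fintype.sum_sum_type, Fintype.sum_prod_type]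
  have h := s.sum_pilot_mul_star hT k k'
  rcases i with l | ⟨b, r⟩ <;> rcases i' with l' | ⟨b', r'⟩
  · simp [coefRC, varRC, blockDiagonal_apply, Matrix.one_apply]
    rw [Fintype.sum_eq_single l' fun x hx => by simp [hx.symm],
      Fintype.sum_eq_single k' fun x hx => by simp [hx.symm]]
    by_cases h1 : k = k' <;> by_cases h2 : l = l' <;> simp [h1, h2]
  · simp [coefRC, varRC, blockDiagonal_apply]
  · simp [coefRC, varRC, blockDiagonal_apply]
  · simp [coefRC, varRC, blockDiagonal_apply, Matrix.one_apply]
    rw [Fintype.sum_eq_single b fun x hx => by simp [hx.symm],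
      Fintype.sum_eq_single r fun x hx => by simp [hx.symm]]
    by_cases h2 : b' = b ∧ r' = r
    · obtain ⟨rfl, rfl⟩ := h2
      simpa using h
    · have h3 : ¬(b = b' ∧ r = r') := fun h => h2 ⟨h.1.symm, h.2.symm⟩
      simp [h2, h3]

lemma coefBS_mul_diagonal_mul (hT : 0 < T) :
    s.coefBS * diagonal (fun i => (s.varBS i : ℂ)) * s.coefBSᴴ
      = fromBlocks (s.β • 1) 0 0 (s.noiseVar • 1) := by
  ext i i'
  rw [Matrix.mul_apply]
  simp only [mul_diagonal, conjTranspose_apply, Fintype.sum_sum_type, Fintype.sum_prod_type]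
  rcases i with ⟨l, m⟩ | ⟨⟨b, k⟩, m⟩ <;> rcases i' with ⟨l', m'⟩ | ⟨⟨b', k'⟩, m'⟩
  · simp [coefBS, varBS, Matrix.one_apply]
    rw [Fintype.sum_eq_single m' fun x hx => by simp [hx.symm],
      Fintype.sum_eq_single l' fun x hx => by simp [hx.symm]]
    simp
  · simp [coefBS, varBS]
  · simp [coefBS, varBS]
  · simp [coefBS, varBS, Matrix.one_apply]
    have h := s.sum_pilot_mul_star hT k k'
    rw [Fintype.sum_eq_single b fun x hx => by simp [hx.symm],
      Fintype.sum_eq_single m fun x hx => by simp [hx.symm]]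
    by_cases h2 : b' = b ∧ m' = m
    · obtain ⟨rfl, rfl⟩ := h2
      simpa using h
    · have h3 : ¬(b = b' ∧ m = m') := fun h => h2 ⟨h.1.symm, h.2.symm⟩
      simp only [h2, if_false, map_zero, mul_zero, Finset.sum_const_zero, ite_self]
      rw [if_neg fun h => h3 ⟨h.1.1, h.2⟩]

end HRISSystem

namespace HRISSystem

variable {M N K Nr T B : ℕ} (s : HRISSystem M N K Nr T B)

/-! ### Estimation of the user channels -/

/-- The matrix with rows `(b, k)` that maps a row of `H` to the noiseless signal, when the user
channels have the entries `g`. -/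
def chanMat (g : Fin N × Fin K → ℂ) : Matrix (Fin B × Fin K) (Fin N) ℂ :=
  Matrix.of fun p l => s.refl p.1 l * g (l, p.2)

lemma chanMat_add (g g' : Fin N × Fin K → ℂ) :
    s.chanMat (g + g') = s.chanMat g + s.chanMat g' := by
  ext p l; simp [chanMat, mul_add]

/-- The matrix of the observation of all antennas. -/
abbrev chanMatAll (g : Fin N × Fin K → ℂ) :
    Matrix ((Fin B × Fin K) × Fin M) (Fin N × Fin M) ℂ :=
  s.chanMat g ⊗ₖ (1 : Matrix (Fin M) (Fin M) ℂ)

/-- The minimum mean squared error filter for the channel of user `k`. It differs from the filter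
`s.Mo` that the surface uses unless all path gains are equal. -/
def userFilter (k : Fin K) : Matrix (Fin N) (Fin B × Fin Nr) ℂ :=
  wiener (s.γ k) (s.noiseVar • 1) s.Arc

/-- The observation at the surface in terms of channels and projected noise. -/
def obsMat : Matrix ((Fin B × Fin Nr) × Fin K) ((Fin N ⊕ (Fin B × Fin Nr)) × Fin K) ℂ :=
  blockDiagonal fun _ => fromCols s.Arc 1

/-- The estimation error of the user channels in terms of channels and projected noise. -/
def errMat : Matrix (Fin N × Fin K) ((Fin N ⊕ (Fin B × Fin Nr)) × Fin K) ℂ :=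
  blockDiagonal fun k => fromCols (1 - s.userFilter k * s.Arc) (-s.userFilter k)

/-- The covariance matrix of channels and projected noise. -/
def covRC : Matrix ((Fin N ⊕ (Fin B × Fin Nr)) × Fin K) ((Fin N ⊕ (Fin B × Fin Nr)) × Fin K) ℂ :=
  blockDiagonal fun k => fromBlocks (s.γ k • 1) 0 0 (s.noiseVar • 1)

lemma obsMat_mul_covRC_mul : s.obsMat * s.covRC * s.obsMatᴴ
    = blockDiagonal fun k => s.γ k • (s.Arc * s.Arcᴴ) + s.noiseVar • 1 := by
  rw [obsMat, covRC, blockDiagonal_conjTranspose, ← blockDiagonal_mul, ← blockDiagonal_mul]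
  congr 1
  ext1 k
  rw [fromCols_mul_fromBlocks, conjTranspose_fromCols_eq_fromRows_conjTranspose,
    fromCols_mul_fromRows]
  simp

lemma errMat_mul_covRC_mul (hT : 0 < T) : s.errMat * s.covRC * s.errMatᴴ
    = blockDiagonal fun k => errCov (s.γ k) s.noiseVar s.Arc := by
  rw [errMat, covRC, blockDiagonal_conjTranspose, ← blockDiagonal_mul, ← blockDiagonal_mul]
  congr 1
  ext1 k
  rw [fromCols_mul_fromBlocks, conjTranspose_fromCols_eq_fromRows_conjTranspose,
    fromCols_mul_fromRows, ← errCov_eq_add _ (s.γ_pos k) (s.noiseVar_pos hT), userFilter]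
  simp

/-- The estimation error is uncorrelated with the observation. -/
lemma errMat_mul_covRC_mul_obsMat (hT : 0 < T) : s.errMat * s.covRC * s.obsMatᴴ = 0 := by
  rw [errMat, covRC, obsMat, blockDiagonal_conjTranspose, ← blockDiagonal_mul, ← blockDiagonal_mul]
  refine Eq.trans (congrArg _ ?_) blockDiagonal_zero
  ext1 k
  have h := one_sub_wiener_mul_mul s.Arc (s.γ_pos k).le (s.noiseVar_pos hT)
  rw [fromCols_mul_fromBlocks, conjTranspose_fromCols_eq_fromRows_conjTranspose,
    fromCols_mul_fromRows]
  simp only [Matrix.mul_smul, Matrix.smul_mul, Matrix.mul_one, Matrix.mul_zero, add_zero, zero_add,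
    conjTranspose_one] at h ⊢
  rw [userFilter, h, smul_neg, add_neg_cancel]
  rfl

lemma filter_mul_obsMat_add_errMat : (blockDiagonal s.userFilter) * s.obsMat + s.errMat
    = blockDiagonal fun _ => fromCols 1 0 := by
  rw [obsMat, errMat, ← blockDiagonal_mul, ← blockDiagonal_add]
  congr 1
  ext1 k
  simp only [Pi.add_apply, mul_fromCols]
  ext i (j | j) <;> simp

lemma filter_mul_cov_mul (hT : 0 < T) :
    blockDiagonal s.userFilter * (blockDiagonal fun k => s.γ k • (s.Arc * s.Arcᴴ) + s.noiseVar • 1)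
      * (blockDiagonal s.userFilter)ᴴ = blockDiagonal fun k => estCov (s.γ k) s.noiseVar s.Arc := by
  rw [blockDiagonal_conjTranspose, ← blockDiagonal_mul, ← blockDiagonal_mul]
  congr 1
  ext1 k
  exact estCov_eq _ (s.γ_pos k).le (s.noiseVar_pos hT)

namespace Channels

variable {s} {Ω : Type*} [MeasurableSpace Ω] {P : Measure Ω} (c : s.Channels P)

/-- The user channels and the noise at the surface. -/
def varsRC : (Fin N × Fin K) ⊕ (Fin B × Fin Nr × Fin T) → Ω → ℂ :=
  Sum.elim (fun p ω => c.G ω p.1 p.2) (fun p ω => c.Zrc ω p.1 p.2.1 p.2.2)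

/-- The channel `H` and the noise at the base station. -/
def varsBS : (Fin M × Fin N) ⊕ (Fin B × Fin M × Fin T) → Ω → ℂ :=
  Sum.elim (fun p ω => c.H ω p.1 p.2) (fun p ω => c.Zbs ω p.1 p.2.1 p.2.2)

/-- The user channels and the projected noise at the surface. -/
def stateRC (ω : Ω) : (Fin N ⊕ (Fin B × Fin Nr)) × Fin K → ℂ :=
  s.coefRC *ᵥ fun i => c.varsRC i ω

/-- The vector `vec H` and the projected noise at the base station. -/
def stateBS (ω : Ω) : (Fin N × Fin M) ⊕ ((Fin B × Fin K) × Fin M) → ℂ :=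
  s.coefBS *ᵥ fun i => c.varsBS i ω

/-- The projected signal at the surface, as a vector. -/
def obs (ω : Ω) : (Fin B × Fin Nr) × Fin K → ℂ := s.obsMat *ᵥ c.stateRC ω

/-- The minimum mean squared error estimate of the user channels. -/
def gBar (ω : Ω) : Fin N × Fin K → ℂ := blockDiagonal s.userFilter *ᵥ c.obs ω

/-- The error of the estimate `gBar`. -/
def gErr (ω : Ω) : Fin N × Fin K → ℂ := s.errMat *ᵥ c.stateRC ω

lemma hasLaw_varsRC (i) : HasLaw (c.varsRC i) (complexGaussian (s.varRC i)) P := by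
  rcases i with p | p
  · exact c.law_G p.1 p.2
  · exact c.law_Zrc p.1 p.2.1 p.2.2

lemma hasLaw_varsBS (i) : HasLaw (c.varsBS i) (complexGaussian (s.varBS i)) P := by
  rcases i with p | p
  · exact c.law_H p.1 p.2
  · exact c.law_Zbs p.1 p.2.1 p.2.2

lemma varRC_nonneg (i) : 0 ≤ s.varRC i := by
  rcases i with p | p
  exacts [(s.γ_pos _).le, s.σsq_pos.le]

lemma varBS_nonneg (i) : 0 ≤ s.varBS i := by
  rcases i with p | p
  exacts [s.β_pos.le, s.σsq_pos.le]

lemma iIndepFun_varsRC : iIndepFun c.varsRC P := by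
  have h := c.indep.precomp (g := Sum.elim (Sum.inr ∘ Sum.inl) (Sum.inr ∘ Sum.inr ∘ Sum.inl))
    (by rintro (a | a) (b | b) <;> simp)
  convert h using 1
  funext i
  rcases i with p | p <;> rfl

lemma iIndepFun_varsBS : iIndepFun c.varsBS P := by
  have h := c.indep.precomp (g := Sum.elim Sum.inl (Sum.inr ∘ Sum.inr ∘ Sum.inr))
    (by rintro (a | a) (b | b) <;> simp)
  convert h using 1
  funext i
  rcases i with p | p <;> rfl

lemma indepFun_varsBS_varsRC :
    IndepFun (fun ω i => c.varsBS i ω) (fun ω i => c.varsRC i ω) P := by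
  have h := ProbabilityTheory.iIndepFun.indepFun_comp_comp c.indep (by
      rintro (p | p | p | p)
      · exact (c.law_H p.1 p.2).aemeasurable
      · exact (c.law_G p.1 p.2).aemeasurable
      · exact (c.law_Zrc p.1 p.2.1 p.2.2).aemeasurable
      · exact (c.law_Zbs p.1 p.2.1 p.2.2).aemeasurable)
    (f := Sum.elim Sum.inl (Sum.inr ∘ Sum.inr ∘ Sum.inr))
    (g := Sum.elim (Sum.inr ∘ Sum.inl) (Sum.inr ∘ Sum.inr ∘ Sum.inl))
    (by rintro (a | a) (b | b) <;> simp)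
  convert h using 1
  · funext ω i
    rcases i with p | p <;> rfl
  · funext ω i
    rcases i with p | p <;> rfl

lemma aemeasurable_varsRC : AEMeasurable (fun ω i => c.varsRC i ω) P :=
  aemeasurable_pi_lambda _ fun i => (c.hasLaw_varsRC i).aemeasurable

lemma aemeasurable_varsBS : AEMeasurable (fun ω i => c.varsBS i ω) P :=
  aemeasurable_pi_lambda _ fun i => (c.hasLaw_varsBS i).aemeasurable

lemma stateRC_inl (ω : Ω) (l : Fin N) (k : Fin K) : c.stateRC ω (Sum.inl l, k) = c.G ω l k := by
  simp only [stateRC, mulVec, dotProduct, Fintype.sum_sum_type, Fintype.sum_prod_type]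
  simp [coefRC, varsRC, ite_and]

lemma stateRC_inr (ω : Ω) (b : Fin B) (r : Fin Nr) (k : Fin K) :
    c.stateRC ω (Sum.inr (b, r), k) = s.pilotScale * (c.Zrc ω b * s.Sᴴ) r k := by
  simp only [stateRC, mulVec, dotProduct, Fintype.sum_sum_type, Fintype.sum_prod_type]
  rw [Fintype.sum_eq_single b fun x hx => by simp [coefRC, hx.symm],
      Fintype.sum_eq_single r fun x hx => by simp [coefRC, hx.symm]]
  simp [coefRC, varsRC, Matrix.mul_apply, Finset.mul_sum, mul_assoc, mul_comm (c.Zrc ω b r _)]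

lemma stateBS_inl (ω : Ω) (p : Fin N × Fin M) :
    c.stateBS ω (Sum.inl p) = (c.H ω).vec p := by
  obtain ⟨l, m⟩ := p
  simp only [stateBS, mulVec, dotProduct, Fintype.sum_sum_type, Fintype.sum_prod_type]
  simp [coefBS, varsBS, ite_and, vec]

lemma stateBS_inr (ω : Ω) (b : Fin B) (k : Fin K) (m : Fin M) :
    c.stateBS ω (Sum.inr ((b, k), m)) = s.pilotScale * (c.Zbs ω b * s.Sᴴ) m k := by
  simp only [stateBS, mulVec, dotProduct, Fintype.sum_sum_type, Fintype.sum_prod_type]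
  rw [Fintype.sum_eq_single b fun x hx => by simp [coefBS, hx.symm],
      Fintype.sum_eq_single m fun x hx => by simp [coefBS]]
  simp [coefBS, varsBS, Matrix.mul_apply, Finset.mul_sum, mul_assoc, mul_comm (c.Zbs ω b m _)]

/-- The projection on the pilots recovers the channels up to noise. -/
lemma proj_pilots (hT : 0 < T) {n : ℕ} (X : Matrix (Fin n) (Fin K) ℂ)
    (Z : Matrix (Fin n) (Fin T) ℂ) :
    (s.pilotScale : ℂ) • ((((√s.Pt : ℝ) : ℂ) • (X * s.S) + Z) * s.Sᴴ)
      = X + (s.pilotScale : ℂ) • (Z * s.Sᴴ) := by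
  have h : (s.pilotScale : ℂ) * (√s.Pt : ℝ) * T = 1 := by
    exact_mod_cast s.pilotScale_mul_sqrt_mul hT
  rw [Matrix.add_mul, smul_add, Matrix.smul_mul, Matrix.mul_assoc, s.S_orth, Matrix.mul_smul,
    Matrix.mul_one, smul_smul, smul_smul, h, one_smul]

lemma obs_eq (hT : 0 < T) (ω : Ω) (p : Fin B × Fin Nr) (k : Fin K) :
    c.obs ω (p, k) = c.yRCProj ω p k := by
  obtain ⟨b, r⟩ := p
  have h1 : c.yRCProj ω (b, r) k = ((s.pilotScale : ℂ) • (c.yRC ω b * s.Sᴴ)) r k := by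
    simp [yRCProj, pilotScale, Matrix.mul_apply]
  rw [h1, yRC, proj_pilots hT, Matrix.add_apply, Matrix.smul_apply, smul_eq_mul, ← stateRC_inr]
  simp only [obs, obsMat, mulVec, dotProduct, Fintype.sum_prod_type, Fintype.sum_sum_type,
    blockDiagonal_apply]
  simp [stateRC_inl, Matrix.mul_apply, Arc, Matrix.one_apply, ite_and, Prod.ext_iff]

lemma gBar_add_gErr (ω : Ω) (l : Fin N) (k : Fin K) :
    (c.gBar ω + c.gErr ω) (l, k) = c.G ω l k := by
  rw [gBar, obs, gErr, mulVec_mulVec, ← add_mulVec, filter_mul_obsMat_add_errMat, ← stateRC_inl]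
  simp only [mulVec, dotProduct, Fintype.sum_prod_type, Fintype.sum_sum_type, blockDiagonal_apply]
  simp [Matrix.one_apply]

lemma yBSVec_eq (hT : 0 < T) (ω : Ω) (p : (Fin B × Fin K) × Fin M) :
    c.yBSVec ω p = (s.chanMatAll (c.gBar ω + c.gErr ω) *ᵥ fun i => c.stateBS ω (Sum.inl i)) p
      + c.stateBS ω (Sum.inr p) := by
  obtain ⟨⟨b, k⟩, m⟩ := p
  rw [stateBS_inr, yBSVec, vec, yBSProj, yBS]
  have := proj_pilots (s := s) hT (c.H ω * s.Psi b * c.G ω) (c.Zbs ω b)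
  rw [pilotScale] at this
  rw [this, Matrix.add_apply, Matrix.smul_apply, smul_eq_mul, pilotScale]
  congr 1
  simp only [mulVec, dotProduct, Fintype.sum_prod_type, kroneckerMap_apply, chanMat, gBar_add_gErr,
    stateBS_inl, vec, Matrix.of_apply]
  rw [Matrix.mul_apply]
  refine Finset.sum_congr rfl fun l _ => ?_
  simp [Psi_eq, Matrix.one_apply]
  ring

end Channels

end HRISSystem

namespace HRISSystem

variable {M N K Nr T B : ℕ} (s : HRISSystem M N K Nr T B)

/-! ### The conditional mean squared error -/

/-- The covariance matrix of noise and channel estimation error at the base station, given the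
signal at the surface. -/
def effNoise : Matrix ((Fin B × Fin K) × Fin M) ((Fin B × Fin K) × Fin M) ℂ :=
  s.noiseVar • 1 + s.β • (s.condCov ⊗ₖ (1 : Matrix (Fin M) (Fin M) ℂ))

lemma posDef_effNoise (hT : 0 < T) : s.effNoise.PosDef :=
  (PosDef.one.smul (s.noiseVar_pos hT)).add_posSemidef
    (((s.posSemidef_condCov hT).kronecker PosSemidef.one).smul s.β_pos.le)

lemma posSemidef_effNoise_sub (hK : 0 < K) (hT : 0 < T) :
    (s.effNoise - (s.lam ⊗ₖ (diagonal fun k => (s.share k : ℂ)))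
      ⊗ₖ (1 : Matrix (Fin M) (Fin M) ℂ)).PosSemidef := by
  have h := (s.posSemidef_condCov_sub hK hT).kronecker
    (PosSemidef.one (n := Fin M) (R := ℂ))
  rwa [sub_kronecker, add_kronecker, smul_kronecker, smul_kronecker, one_kronecker_one] at h

/-- The surface's estimate as a function of the vector of observations. -/
def ghatOf (o : (Fin B × Fin Nr) × Fin K → ℂ) : Matrix (Fin N) (Fin K) ℂ :=
  s.Mo * Matrix.of fun p k => o (p, k)

lemma measurable_mulVec_apply {m n : Type*} [Fintype n] (A : Matrix m n ℂ) (i : m) :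
    Measurable fun v : n → ℂ => (A *ᵥ v) i := by
  simp only [mulVec, dotProduct]
  fun_prop

lemma measurable_mulVec {m n : Type*} [Fintype n] (A : Matrix m n ℂ) :
    Measurable fun v : n → ℂ => A *ᵥ v :=
  measurable_pi_lambda _ fun i => measurable_mulVec_apply A i

lemma measurable_chanMatAll {Z : Type*} [MeasurableSpace Z] {g : Z → Fin N × Fin K → ℂ}
    (hg : Measurable g) (p) (i : Fin N × Fin M) : Measurable fun z => s.chanMatAll (g z) p i := by
  simp only [chanMatAll, kroneckerMap_apply, chanMat, Matrix.of_apply]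
  exact (((measurable_pi_apply _).comp hg).const_mul _).mul_const _

lemma LinEst.measurable_comp (e : LinEst M N K B) {Z : Type*} [MeasurableSpace Z]
    {f : Z → Matrix (Fin N) (Fin K) ℂ} (hf : ∀ l k, Measurable fun z => f z l k) (i j) :
    Measurable fun z => e.W (f z) i j :=
  (e.measurable_W i j).comp (measurable_pi_lambda (fun z l k => f z l k) fun l =>
    measurable_pi_lambda _ fun k => hf l k)

lemma measurable_ghatOf (l : Fin N) (k : Fin K) :
    Measurable fun o : (Fin B × Fin Nr) × Fin K → ℂ => s.ghatOf o l k :=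
  measurable_mul_apply (A := fun _ => s.Mo) (fun _ _ => measurable_const)
    (fun p k => measurable_pi_apply (p, k)) l k

namespace Channels

variable {s} {Ω : Type*} [MeasurableSpace Ω] {P : Measure Ω} [IsProbabilityMeasure P]
  (c : s.Channels P)

omit [IsProbabilityMeasure P] in
lemma Ghat_eq (hT : 0 < T) (ω : Ω) : c.Ghat ω = s.ghatOf (c.obs ω) := by
  rw [Ghat, ghatOf]
  congr 1
  ext p k
  exact (c.obs_eq hT ω p k).symm

lemma hasCov_stateRC (hT : 0 < T) : HasCov c.stateRC s.covRC P := by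
  have h := (hasCov_of_iIndepFun (varRC_nonneg (s := s)) c.hasLaw_varsRC
    c.iIndepFun_varsRC).mulVec s.coefRC
  rwa [s.coefRC_mul_diagonal_mul hT] at h

lemma hasCov_stateBS (hT : 0 < T) :
    HasCov c.stateBS (fromBlocks (s.β • 1) 0 0 (s.noiseVar • 1)) P := by
  have h := (hasCov_of_iIndepFun (varBS_nonneg (s := s)) c.hasLaw_varsBS
    c.iIndepFun_varsBS).mulVec s.coefBS
  rwa [s.coefBS_mul_diagonal_mul hT] at h

lemma hasCov_gErr (hT : 0 < T) :
    HasCov c.gErr (blockDiagonal fun k => errCov (s.γ k) s.noiseVar s.Arc) P := by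
  have h := (c.hasCov_stateRC hT).mulVec s.errMat
  rwa [s.errMat_mul_covRC_mul hT] at h

lemma hasCov_gBar (hT : 0 < T) :
    HasCov c.gBar (blockDiagonal fun k => estCov (s.γ k) s.noiseVar s.Arc) P := by
  have h := ((c.hasCov_stateRC hT).mulVec s.obsMat).mulVec (blockDiagonal s.userFilter)
  rwa [s.obsMat_mul_covRC_mul, s.filter_mul_cov_mul hT] at h

/-- The error of the estimate of the user channels is independent of everything that the surface
observes. -/
lemma indepFun_gErr_obs (hT : 0 < T) : IndepFun c.gErr c.obs P := by
  have h := indepFun_mulVec_of_mul_diagonal_mul_eq_zero (varRC_nonneg (s := s)) c.hasLaw_varsRC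
    c.iIndepFun_varsRC (s.errMat * s.coefRC) (s.obsMat * s.coefRC) (by
      have h := s.errMat_mul_covRC_mul_obsMat hT
      rw [covRC, ← s.coefRC_mul_diagonal_mul hT] at h
      simpa only [conjTranspose_mul, Matrix.mul_assoc] using h)
  simp only [← mulVec_mulVec] at h
  exact h

lemma lintegral_stateBS (hT : 0 < T)
    (U : Matrix ((Fin B × Fin K) × Fin M) (Fin N × Fin M) ℂ)
    (W : Matrix (Fin N × Fin M) ((Fin B × Fin K) × Fin M) ℂ) :
    ∫⁻ ω, ∑ i, ‖(fromCols (1 - W * U) (-W) *ᵥ c.stateBS ω) i‖ₑ ^ 2 ∂P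
      = ENNReal.ofReal (risk s.β (s.noiseVar • 1) U W) := by
  rw [((c.hasCov_stateBS hT).mulVec (fromCols (1 - W * U) (-W))).lintegral_enorm_sq, risk,
    fromCols_mul_fromBlocks, conjTranspose_fromCols_eq_fromRows_conjTranspose,
    fromCols_mul_fromRows]
  simp

lemma lintegral_gErr (hT : 0 < T) (g : Fin N × Fin K → ℂ)
    (W : Matrix (Fin N × Fin M) ((Fin B × Fin K) × Fin M) ℂ) :
    ∫⁻ ω, ENNReal.ofReal (risk s.β (s.noiseVar • 1) (s.chanMatAll (g + c.gErr ω)) W) ∂P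
      = ENNReal.ofReal (risk s.β s.effNoise (s.chanMatAll g) W) := by
  have h := c.hasCov_gErr hT
  have hadd : ∀ ω, s.chanMatAll (g + c.gErr ω)
      = s.chanMatAll (M := M) g + s.chanMatAll (c.gErr ω) := fun ω => by
    rw [chanMatAll, chanMat_add, add_kronecker]
  have hsq : ∀ ω p q, (s.chanMat (c.gErr ω) * (s.chanMat (c.gErr ω))ᴴ) p q
      = ∑ l, s.refl p.1 l * star (s.refl q.1 l)
        * (c.gErr ω (l, p.2) * star (c.gErr ω (l, q.2))) := fun ω p q => by
    rw [Matrix.mul_apply]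
    refine Finset.sum_congr rfl fun l _ => ?_
    simp only [chanMat, conjTranspose_apply, Matrix.of_apply, star_mul']
    ring
  have hint : ∀ p q, Integrable (fun ω => (s.chanMat (c.gErr ω) * (s.chanMat (c.gErr ω))ᴴ) p q) P :=
    fun p q => by
      simp_rw [hsq]
      exact integrable_finsetSum _ fun l _ => (h.integrable_mul_star _ _).const_mul _
  have hcov : ∀ p q, ∫ ω, (s.chanMat (c.gErr ω) * (s.chanMat (c.gErr ω))ᴴ) p q ∂P
      = s.condCov p q := by
    rintro ⟨b, k⟩ ⟨b', k'⟩
    simp_rw [hsq]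
    rw [integral_finsetSum _ fun l _ => (h.integrable_mul_star _ _).const_mul _]
    simp_rw [integral_const_mul, h.cov, blockDiagonal_apply]
    rw [condCov, Matrix.mul_apply]
    simp only [mul_diagonal, conjTranspose_apply, kroneckerMap_apply, Fintype.sum_prod_type]
    refine Finset.sum_congr rfl fun l _ => ?_
    rw [Fintype.sum_eq_single k fun i hi => by simp [Ne.symm hi]]
    by_cases hk : k = k'
    · subst hk
      simp only [Matrix.one_apply_eq, mul_one, if_true]
      ring
    · simp [hk, Ne.symm hk]
  simp_rw [hadd]
  rw [effNoise]
  refine lintegral_risk_add s.β_pos.le (PosSemidef.one.smul (s.noiseVar_pos hT).le) _ _ ?_ ?_ ?_ ?_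
  · intro p i
    simp only [chanMatAll, kroneckerMap_apply, chanMat, Matrix.of_apply]
    exact ((h.integrable _).const_mul _).mul_const _
  · intro p i
    simp only [chanMatAll, kroneckerMap_apply, chanMat, Matrix.of_apply]
    rw [integral_mul_const, integral_const_mul, h.mean]
    simp
  · intro p q
    simp only [chanMatAll, conjTranspose_kronecker, ← mul_kronecker_mul, conjTranspose_one,
      Matrix.mul_one]
    simp only [kroneckerMap_apply]
    exact (hint _ _).mul_const _
  · intro p q
    simp only [chanMatAll, conjTranspose_kronecker, ← mul_kronecker_mul, conjTranspose_one,
      Matrix.mul_one]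
    simp only [kroneckerMap_apply]
    rw [integral_mul_const, hcov]

/-- The mean squared error of an estimator is an average over the signal at the surface, of the
risk of a linear estimator in a model with known user channels `gBar` and additional noise. -/
lemma mse_eq (hT : 0 < T) (e : LinEst M N K B) :
    c.mse e = ∫⁻ ω, ENNReal.ofReal
      (risk s.β s.effNoise (s.chanMatAll (c.gBar ω)) (e.W (c.Ghat ω))) ∂P := by
  have h1 : c.mse e = ∫⁻ ω, ∑ i, ‖(fromCols
      (1 - e.W (s.ghatOf (c.obs ω)) * s.chanMatAll (c.gBar ω + c.gErr ω))
      (-e.W (s.ghatOf (c.obs ω))) *ᵥ c.stateBS ω) i‖ₑ ^ 2 ∂P := by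
    refine lintegral_congr fun ω => Finset.sum_congr rfl fun i _ => ?_
    congr 2
    have hs : c.stateBS ω = Sum.elim (c.H ω).vec (fun p => c.stateBS ω (Sum.inr p)) := by
      ext (p | p)
      · exact c.stateBS_inl ω p
      · rfl
    have hy : c.yBSVec ω = s.chanMatAll (c.gBar ω + c.gErr ω) *ᵥ (c.H ω).vec
        + fun p => c.stateBS ω (Sum.inr p) := by
      ext p
      rw [c.yBSVec_eq hT]
      simp only [c.stateBS_inl, Pi.add_apply]
    rw [c.Ghat_eq hT, hs, fromCols_mulVec, hy]
    simp only [Function.comp_def, Sum.elim_inl, Sum.elim_inr, sub_mulVec, one_mulVec, neg_mulVec,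
      mulVec_add, mulVec_mulVec, Pi.add_apply, Pi.sub_apply, Pi.neg_apply]
    ring
  -- Average over `H` and the noise at the base station first, then over the error `gErr`.
  have h2 := c.indepFun_varsBS_varsRC.lintegral_comp_prodMk c.aemeasurable_varsBS
    c.aemeasurable_varsRC (F := fun u v => ∑ i, ‖(fromCols
      (1 - e.W (s.ghatOf (s.obsMat *ᵥ s.coefRC *ᵥ v)) * s.chanMatAll
        (blockDiagonal s.userFilter *ᵥ s.obsMat *ᵥ s.coefRC *ᵥ v + s.errMat *ᵥ s.coefRC *ᵥ v))
      (-e.W (s.ghatOf (s.obsMat *ᵥ s.coefRC *ᵥ v))) *ᵥ s.coefBS *ᵥ u) i‖ₑ ^ 2) (by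
    have hv : Measurable fun z : ((Fin M × Fin N) ⊕ (Fin B × Fin M × Fin T) → ℂ)
        × ((Fin N × Fin K) ⊕ (Fin B × Fin Nr × Fin T) → ℂ) =>
        s.obsMat *ᵥ s.coefRC *ᵥ z.2 :=
      (measurable_mulVec s.obsMat).comp ((measurable_mulVec s.coefRC).comp measurable_snd)
    have hW := e.measurable_comp fun l k => (s.measurable_ghatOf l k).comp hv
    have hU := s.measurable_chanMatAll (M := M)
      (((measurable_mulVec (blockDiagonal s.userFilter)).comp hv).add
        ((measurable_mulVec s.errMat).comp ((measurable_mulVec s.coefRC).comp measurable_snd)))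
    have hWU := measurable_mul_apply hW hU
    refine Finset.measurable_fun_sum _ fun i _ => (Measurable.enorm ?_).pow_const 2
    refine Finset.measurable_fun_sum _ fun j _ => Measurable.mul ?_
      ((measurable_mulVec_apply s.coefBS j).comp measurable_fst)
    rcases j with j | j
    · exact (measurable_const (a := (1 : Matrix (Fin N × Fin M) _ ℂ) i j)).sub (hWU i j)
    · exact (hW i j).neg)
  have hv : AEMeasurable c.stateRC P :=
    (measurable_mulVec s.coefRC).comp_aemeasurable c.aemeasurable_varsRC
  have h3 := (c.indepFun_gErr_obs hT).lintegral_comp_prodMk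
    ((measurable_mulVec s.errMat).comp_aemeasurable hv)
    ((measurable_mulVec s.obsMat).comp_aemeasurable hv)
    (F := fun x o => ENNReal.ofReal (risk s.β (s.noiseVar • 1)
      (s.chanMatAll (blockDiagonal s.userFilter *ᵥ o + x)) (e.W (s.ghatOf o)))) (by
    refine (measurable_risk _ _ (s.measurable_chanMatAll ?_)
      (e.measurable_comp fun l k => (s.measurable_ghatOf l k).comp measurable_snd)).ennreal_ofReal
    exact ((measurable_mulVec _).comp measurable_snd).add measurable_fst)
  rw [h1]
  refine h2.trans (Eq.trans (lintegral_congr fun ω => ?_)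
    (h3.trans (lintegral_congr fun ω => ?_)))
  · exact c.lintegral_stateBS hT _ _
  · rw [c.Ghat_eq hT]
    exact c.lintegral_gErr hT _ _

end Channels

end HRISSystem

namespace HRISSystem

variable {M N K Nr T B : ℕ} {s : HRISSystem M N K Nr T B}

namespace Channels

variable {Ω : Type*} [MeasurableSpace Ω] {P : Measure Ω} [IsProbabilityMeasure P]
  (c : s.Channels P)

/-! ### The optimal estimator -/

omit [IsProbabilityMeasure P] in
/-- Although the surface does not use the filters of the individual users, their estimates can be
computed from the one that it conveys. -/
lemma exists_gBar_eq (hK : 0 < K) (hT : 0 < T) :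
    ∃ F : Matrix (Fin N × Fin K) (Fin N × Fin K) ℂ,
      ∀ ω, c.gBar ω = F *ᵥ fun p => c.Ghat ω p.1 p.2 := by
  choose F hF using fun k => exists_mul_wiener_eq s.Arc (s.γ_pos k) (s.noiseVar_pos hT)
    (s.gain_pos hK) (mul_pos (Nat.cast_pos.2 hK) (s.noiseVar_pos hT))
  refine ⟨blockDiagonal F, fun ω => ?_⟩
  have h1 : (fun p : Fin N × Fin K => c.Ghat ω p.1 p.2)
      = (blockDiagonal fun _ => s.Mo) *ᵥ c.obs ω := by
    ext ⟨l, k⟩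
    rw [c.Ghat_eq hT, ghatOf, Matrix.mul_apply]
    simp [mulVec, dotProduct, Fintype.sum_prod_type, blockDiagonal_apply]
  rw [h1, mulVec_mulVec, ← blockDiagonal_mul, gBar]
  congr 2
  ext1 k
  rw [s.Mo_eq, hF, userFilter]

lemma exists_isLMMSE (hK : 0 < K) (hT : 0 < T) : ∃ e : LinEst M N K B, c.IsLMMSE e := by
  obtain ⟨F, hF⟩ := c.exists_gBar_eq hK hT
  refine ⟨⟨fun g => wiener s.β s.effNoise (s.chanMatAll (F *ᵥ fun p => g p.1 p.2)), fun i j => ?_⟩,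
    fun e' => ?_⟩
  · refine measurable_wiener_apply _ _ (s.measurable_chanMatAll ?_) i j
    refine (measurable_mulVec F).comp (measurable_pi_lambda _ fun p => ?_)
    exact (measurable_pi_apply p.2).comp (measurable_pi_apply p.1)
  · rw [c.mse_eq hT, c.mse_eq hT]
    refine lintegral_mono fun ω => ENNReal.ofReal_le_ofReal ?_
    simp only [hF]
    exact risk_wiener_le s.β_pos.le (s.posDef_effNoise hT) _ _

/-- The zero estimator has finite mean squared error. -/
lemma mse_ne_top_of_isLMMSE (hT : 0 < T) {e : LinEst M N K B} (he : c.IsLMMSE e) :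
    c.mse e ≠ ∞ := by
  refine ne_top_of_le_ne_top ?_ (he ⟨fun _ => 0, fun _ _ => measurable_const⟩)
  rw [c.mse_eq hT]
  simp [risk]

/-! ### The lower bound -/

lemma inv_lam_kronecker_share (hK : 0 < K) :
    ((s.lam ⊗ₖ (diagonal fun k => (s.share k : ℂ))) ⊗ₖ (1 : Matrix (Fin M) (Fin M) ℂ))⁻¹
      = ((s.lam)⁻¹ ⊗ₖ diagonal fun k => ((s.share k : ℂ))⁻¹) ⊗ₖ 1 := by
  have h : (diagonal fun k => (s.share k : ℂ))⁻¹ = diagonal fun k => ((s.share k : ℂ))⁻¹ := by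
    refine inv_eq_left_inv ?_
    rw [diagonal_mul_diagonal, ← diagonal_one]
    congr 1
    ext k
    exact inv_mul_cancel₀ (Complex.ofReal_ne_zero.2 (s.share_pos hK k).ne')
  rw [inv_kronecker, inv_kronecker, h, inv_one]

variable (s) in
lemma chanMat_info_apply (g : Fin N × Fin K → ℂ) (l l' : Fin N) :
    ((s.chanMat g)ᴴ * ((s.lam)⁻¹ ⊗ₖ diagonal fun k => ((s.share k : ℂ))⁻¹) * s.chanMat g) l l'
      = ∑ k, ∑ j, ∑ i, ((s.share k : ℂ))⁻¹ * (s.lam)⁻¹ j i * s.refl i l' * star (s.refl j l)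
        * (g (l', k) * star (g (l, k))) := by
  simp only [Matrix.mul_apply, Fintype.sum_prod_type, Finset.sum_mul, kroneckerMap_apply,
    conjTranspose_apply, chanMat, Matrix.of_apply, diagonal_apply, mul_ite, mul_zero,
    star_mul', Finset.sum_ite_eq', Finset.mem_univ, if_true]
  rw [Finset.sum_comm]
  refine Finset.sum_congr rfl fun k _ => Finset.sum_comm.trans ?_
  refine Finset.sum_congr rfl fun j _ => Finset.sum_congr rfl fun i _ => ?_
  ring

lemma integrable_info (hT : 0 < T) (l l' : Fin N) :
    Integrable (fun ω => ((s.chanMat (c.gBar ω))ᴴ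
      * ((s.lam)⁻¹ ⊗ₖ diagonal fun k => ((s.share k : ℂ))⁻¹) * s.chanMat (c.gBar ω)) l l') P := by
  simp only [chanMat_info_apply]
  exact integrable_finsetSum _ fun k _ => integrable_finsetSum _ fun j _ =>
    integrable_finsetSum _ fun i _ => ((c.hasCov_gBar hT).integrable_mul_star _ _).const_mul _

lemma integral_info (hT : 0 < T) (l l' : Fin N) :
    ∫ ω, ((s.chanMat (c.gBar ω))ᴴ
      * ((s.lam)⁻¹ ⊗ₖ diagonal fun k => ((s.share k : ℂ))⁻¹) * s.chanMat (c.gBar ω)) l l' ∂P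
      = (∑ k, (s.share k)⁻¹ • s.infoMap (estCov (s.γ k) s.noiseVar s.Arc)) l l' := by
  have h := c.hasCov_gBar hT
  have hi := fun k j i => (h.integrable_mul_star (l', k) (l, k)).const_mul
    (((s.share k : ℂ))⁻¹ * (s.lam)⁻¹ j i * s.refl i l' * star (s.refl j l))
  simp only [chanMat_info_apply]
  rw [integral_finsetSum _ fun k _ => integrable_finsetSum _ fun j _ =>
    integrable_finsetSum _ fun i _ => hi k j i]
  rw [Matrix.sum_apply]
  refine Finset.sum_congr rfl fun k _ => ?_
  rw [integral_finsetSum _ fun j _ => integrable_finsetSum _ fun i _ => hi k j i,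
    Matrix.smul_apply, infoMap, transpose_apply, Matrix.sum_apply, Finset.smul_sum]
  refine Finset.sum_congr rfl fun j _ => ?_
  rw [integral_finsetSum _ fun i _ => hi k j i, Matrix.sum_apply, Finset.smul_sum]
  refine Finset.sum_congr rfl fun i _ => ?_
  rw [integral_const_mul, h.cov, blockDiagonal_apply_eq, Psi_eq, Psi_eq, diagonal_conjTranspose,
    Matrix.smul_apply, mul_diagonal, diagonal_mul]
  simp only [Complex.real_smul, smul_eq_mul, Pi.star_apply, Complex.ofReal_inv]
  ring

omit [IsProbabilityMeasure P] in
lemma ofReal_integral_le_lintegral_ofReal {f : Ω → ℝ} (hf : Integrable f P) :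
    ENNReal.ofReal (∫ ω, f ω ∂P) ≤ ∫⁻ ω, ENNReal.ofReal (f ω) ∂P := by
  refine ENNReal.ofReal_le_of_le_toReal ?_
  rw [integral_eq_lintegral_pos_part_sub_lintegral_neg_part hf]
  exact sub_le_self _ ENNReal.toReal_nonneg

/-- The bound `le_risk` with `V = J⁻¹`, the inverse of the information matrix of the closed form,
averaged over the signal at the surface. -/
lemma ofReal_EH_le_mse (hK : 0 < K) (hT : 0 < T) (e : LinEst M N K B) :
    ENNReal.ofReal s.EH.re ≤ c.mse e := by
  set Q : Matrix (Fin N) (Fin N) ℂ := (s.infoRow)⁻¹ with hQ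
  set V : Matrix (Fin N × Fin M) (Fin N × Fin M) ℂ := Q ⊗ₖ 1 with hV
  set E : Matrix (Fin N) (Fin N) ℂ :=
    ∑ k, (s.share k)⁻¹ • s.infoMap (estCov (s.γ k) s.noiseVar s.Arc) with hE
  set X : Ω → Matrix (Fin N) (Fin N) ℂ := fun ω => (s.chanMat (c.gBar ω))ᴴ
      * ((s.lam)⁻¹ ⊗ₖ diagonal fun k => ((s.share k : ℂ))⁻¹) * s.chanMat (c.gBar ω) with hX
  have hQh : Qᴴ = Q := (s.posDef_infoRow hK hT).inv.isHermitian
  have hVt : V.trace = M * Q.trace := by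
    rw [hV, trace_kronecker, trace_one, Fintype.card_fin, mul_comm]
  have hVV : (V * Vᴴ).trace = M * (Q * Qᴴ).trace := by
    rw [hV, conjTranspose_kronecker, ← mul_kronecker_mul, trace_kronecker]
    simp [mul_comm]
  have hEH : s.EH = M * Q.trace := by
    rw [EH, infoH_eq, inv_kronecker, inv_one, trace_kronecker, trace_one, Fintype.card_fin,
      mul_comm]
  have hL' : ((s.lam ⊗ₖ (diagonal fun k => (s.share k : ℂ)))
      ⊗ₖ (1 : Matrix (Fin M) (Fin M) ℂ)).PosDef :=
    ((s.posDef_lam hK hT).kronecker (PosDef.diagonal fun k =>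
      Complex.zero_lt_real.2 (s.share_pos hK k))).kronecker PosDef.one
  have hlow : ∀ ω, (M : ℝ) * (2 * Q.trace.re - s.β⁻¹ * (Q * Qᴴ).trace.re
      - (Qᴴ * Q * X ω).trace.re)
      ≤ risk s.β s.effNoise (s.chanMatAll (c.gBar ω)) (e.W (c.Ghat ω)) := by
    intro ω
    have h := le_risk s.β_pos hL' (s.posSemidef_effNoise_sub hK hT) (s.chanMatAll (c.gBar ω))
      (e.W (c.Ghat ω)) V
    have hX' : (V * ((s.chanMatAll (c.gBar ω))ᴴ * ((s.lam ⊗ₖ (diagonal fun k => (s.share k : ℂ)))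
        ⊗ₖ (1 : Matrix (Fin M) (Fin M) ℂ))⁻¹ * s.chanMatAll (c.gBar ω)) * Vᴴ).trace
        = M * (Qᴴ * Q * X ω).trace := by
      rw [inv_lam_kronecker_share hK, chanMatAll, hV, conjTranspose_kronecker,
        conjTranspose_kronecker, ← mul_kronecker_mul, ← mul_kronecker_mul, ← mul_kronecker_mul,
        ← mul_kronecker_mul, trace_kronecker, Matrix.trace_mul_comm _ Qᴴ, ← Matrix.mul_assoc Qᴴ]
      simp [mul_comm, hX]
    rw [hX', trace_smul, hVV, hVt] at h
    refine le_trans (le_of_eq ?_) h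
    simp
    ring
  have hXi := integrable_trace_mul (c.integrable_info hT) (Qᴴ * Q)
  have hint : Integrable (fun ω => (M : ℝ) * (2 * Q.trace.re - s.β⁻¹ * (Q * Qᴴ).trace.re
      - (Qᴴ * Q * X ω).trace.re)) P :=
    ((integrable_const _).sub hXi.re).const_mul _
  rw [c.mse_eq hT]
  refine le_trans ?_ ((ofReal_integral_le_lintegral_ofReal hint).trans
    (lintegral_mono fun ω => ENNReal.ofReal_le_ofReal (hlow ω)))
  refine ENNReal.ofReal_le_ofReal ?_
  have hXre : ∫ ω, (Qᴴ * Q * X ω).trace.re ∂P = (Qᴴ * Q * E).trace.re :=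
    (integral_re hXi).trans
      (congrArg Complex.re (integral_trace_mul (c.integrable_info hT) (c.integral_info hT) _))
  have hXi' : Integrable (fun ω => (Qᴴ * Q * X ω).trace.re) P := hXi.re
  rw [integral_const_mul, integral_sub (integrable_const _) hXi', hXre, hEH]
  -- `J` dominates the expected information, and `Q J Qᴴ = Q`.
  have hdom := ((s.posSemidef_infoMap_sub_sum hK hT).mul_mul_conjTranspose_same Q).re_trace_nonneg
  have hJ : Q * s.infoRow * Qᴴ = Q := by
    rw [hQh, hQ, nonsing_inv_mul _ ((isUnit_iff_isUnit_det _).1 (s.posDef_infoRow hK hT).isUnit),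
      Matrix.one_mul]
  rw [infoRow, Matrix.mul_add, Matrix.add_mul, Matrix.mul_smul, Matrix.smul_mul,
    Matrix.mul_one] at hJ
  have hJt := congrArg (fun A => (Matrix.trace A).re) hJ
  rw [← hE, Matrix.mul_sub, Matrix.sub_mul, trace_sub, Matrix.trace_mul_comm (Q * E),
    ← Matrix.mul_assoc Qᴴ] at hdom
  simp only [trace_add, trace_smul, Complex.add_re, Complex.sub_re, Complex.real_smul,
    Complex.re_ofReal_mul] at hJt hdom
  have : ((M : ℂ) * Q.trace).re = M * Q.trace.re := by simp
  rw [this]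
  refine mul_le_mul_of_nonneg_left ?_ (Nat.cast_nonneg _)
  simp only [integral_const, probReal_univ, one_smul]
  linarith

end Channels

end HRISSystem

end

theorem theorem2 {M N K Nr T B : ℕ} (hK : 0 < K) (hT : 0 < T)
    (s : HRISSystem M N K Nr T B)
    {Ω : Type*} [MeasurableSpace Ω] (P : Measure Ω) [IsProbabilityMeasure P]
    (c : s.Channels P) :
    s.D.PosDef ∧ s.infoH.PosDef ∧ s.EH.im = 0 ∧
      (∃ e : HRISSystem.LinEst M N K B, c.IsLMMSE e) ∧
      (∀ e : HRISSystem.LinEst M N K B, c.IsLMMSE e →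
        c.mse e ≠ ∞ ∧ ENNReal.ofReal s.EH.re ≤ c.mse e) :=
  ⟨s.posDef_D hK hT, s.posDef_infoH hK hT, s.EH_im hK hT, c.exists_isLMMSE hK hT,
    fun e he => ⟨c.mse_ne_top_of_isLMMSE hT he, c.ofReal_EH_le_mse hK hT e⟩⟩
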